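/- **Model.** Let $v_0=1$ and $v_t-v_{t-1}\in\{0,1\}$ for $t\ge1$ be the given (observed, hence treated as deterministic) vertex counts, and let $a_t>-1$ be parameters. The random multigraphs $G_0,G_1,\dots$ are built as follows. $G_0$ is a single isolated vertex whose degree is counted as $1$ (this extra unit stays with it forever). Given $G_0,\dots,G_{t-1}$: if $v_t=v_{t-1}+1$, a new vertex is added and joined by an edge to a vertex $u$ of $G_{t-1}$ chosen with probability proportional to $d(u)+a_t$, where $d(u)$ is the degree of $u$ in $G_{t-1}$; if $v_t=v_{t-1}$, an edge $\{u,w\}$ is added, where $u,w$ are vertices of $G_{t-1}$ chosen independently, each with probability proportional to degree plus $a_t$ ($u=w$ gives a loop, which adds $2$ to the degree). Let $x_t$ be the number of vertices of degree one in $G_t$ and $\Gamma_t=\sigma(x_0,\dots,x_t)$. For $S<T$ and $\alpha>-1$ let $f_{S,T}(\alpha)=E(x_T\mid\Gamma_S)$, computed in the model in which $a_t=\alpha$ for all $t\in[S,T]$ and evaluated at the observed data, and let $$\hat a\in\arg\min_{\alpha>-1}\,(f_{S,T}(\alpha)-x_T)^2,$$ with an arbitrary choice of $\hat a$ where the minimizer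 is not unique or does not exist. **Theorem.** For each positive integer $T$ let such a network be given; its vertex counts $v_t=v^{(T)}_t$, its parameters $a_t=a^{(T)}_t$ and the integer times $S=S_T$, $R=R_T$ may depend on $T$. Assume that there are constants $p>0$ and $K$, independent of $T$, with $v_t/t\ge p$ for all $t>0$ and $-1<a_t\le K$ for all $t$. Let $\alpha_1\ne\alpha_2$ be real numbers in $(-1,\infty)$, independent of $T$, and assume that for all sufficiently large $T$ we have $0\le S<R<T$, $a_t=\alpha_1$ for $t\in[S,R)$ and $a_t=\alpha_2$ for $t\in[R,T]$. Then the following hold. If $\liminf_{T\to\infty}\frac{T-S}{T}>0$ (which is the case in each of (a), (b), (c) below), then with probability tending to one as $T\to\infty$ the minimizer $\hat a$ exists, is unique, and satisfies $f_{S,T}(\hat a)=x_T$. Moreover: (a) If $\lim_{T\to\infty}\frac{T-R}{T}>0$ and $\lim_{T\to\infty}\frac{R-S}{T}>0$, then there is $c>0$ independent of $T$ such that $\min\{|\hat a-\alpha_1|,|\hat a-\alpha_2|\}>c$ with probability tending to one as $T\to\infty$. (b) If $\lim_{T\to\infty}\frac{T-R}{T}>0$ and $\lim_{T\to\infty}\frac{R-S}{T}=0$,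 then $\hat a\to\alpha_2$ in probability as $T\to\infty$. (c) If $\lim_{T\to\infty}\frac{R-S}{T}>0$ and $\lim_{T\to\infty}\frac{T-R}{T}=0$, then $\hat a\to\alpha_1$ in probability as $T\to\infty$. -/

import Mathlib

open MeasureTheory Filter Topology
open scoped ENNReal

noncomputable section

namespace PrefAttach

/-- A finite multigraph, loops and multiple edges allowed, with vertices `0, …, numV - 1`. -/
structure MGraph where
  numV : ℕ
  edges : Multiset (Sym2 ℕ)

/-- The initial graph: one isolated vertex, labelled `0`. -/
def MGraph.init : MGraph := ⟨1, 0⟩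

/-- The degree of `u`: the number of edge ends at `u` (a loop counts twice); the vertex `0` of the
initial graph is given degree one from the start, so it always has one extra unit. -/
def MGraph.degree (g : MGraph) (u : ℕ) : ℕ :=
  (if u = 0 then 1 else 0) + (g.edges.map fun e => e.toMultiset.count u).sum

/-- The number of leaves, that is, of vertices of degree one. -/
def MGraph.leaves (g : MGraph) : ℕ :=
  ((Finset.range g.numV).filter fun u => g.degree u = 1).card

/-- The weight `d(u) + a` of a vertex `u`. -/
def weight (a : ℝ) (g : MGraph) (u : ℕ) : ℝ≥0∞ :=
  if u < g.numV then ENNReal.ofReal ((g.degree u : ℝ) + a) else 0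

theorem tsum_weight_ne_top (a : ℝ) (g : MGraph) : ∑' u, weight a g u ≠ ∞ := by
  have h : ∑' u, weight a g u = ∑ u ∈ Finset.range g.numV, weight a g u := by
    apply tsum_eq_sum
    intro u hu
    simp only [Finset.mem_range] at hu
    simp [weight, hu]
  rw [h]
  refine ENNReal.sum_ne_top.2 fun u _ => ?_
  unfold weight
  split_ifs <;> simp

open Classical in
/-- The law of a random vertex of `g`, chosen with probability proportional to `d(u) + a`.
(The first branch is a default that does not occur when `a > -1` and every vertex of the
nonempty graph `g` has degree at least one.) -/
def chooseVertex (a : ℝ) (g : MGraph) : PMF ℕ :=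
  if h : ∑' u, weight a g u = 0 then PMF.pure 0
  else PMF.normalize (weight a g) h (tsum_weight_ne_top a g)

/-- Vertex-step: add a new vertex (labelled `g.numV`) and join it to a randomly chosen vertex of
the current graph. -/
def vertexStep (a : ℝ) (g : MGraph) : PMF MGraph :=
  (chooseVertex a g).map fun u => ⟨g.numV + 1, s(u, g.numV) ::ₘ g.edges⟩

/-- Edge-step: add an edge between two independently chosen vertices of the current graph. -/
def edgeStep (a : ℝ) (g : MGraph) : PMF MGraph :=
  (chooseVertex a g).bind fun u =>
    (chooseVertex a g).map fun w => ⟨g.numV, s(u, w) ::ₘ g.edges⟩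

/-- Trajectories `(G_0, G_1, …)` of the graph. The laws on trajectories used below are discrete, so
every set of trajectories is taken to be measurable. -/
def Path : Type := ℕ → MGraph

instance : MeasurableSpace Path := ⊤

/-- The law of the graph process up to time `n` (a trajectory is constant from time `n` on), with
attachment parameters `a 1, …, a n` and vertex counts `v 0, …, v n`. Given the past, the graph at
time `n + 1` arises from the graph at time `n` by a vertex-step with parameter `a (n + 1)` if the
number of vertices increases by one, and by an edge-step with this parameter otherwise. -/
def pathLaw (a : ℕ → ℝ) (v : ℕ → ℕ) : ℕ → PMF Path
  | 0 => PMF.pure fun _ => MGraph.init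
  | n + 1 => (pathLaw a v n).bind fun ω =>
      (if v (n + 1) = v n + 1 then vertexStep (a (n + 1)) (ω n)
        else edgeStep (a (n + 1)) (ω n)).map
      fun g => fun s => if s ≤ n then ω s else g

/-- The probability measure of the process with horizon `T`. -/
def law (a : ℕ → ℝ) (v : ℕ → ℕ) (T : ℕ) : Measure Path := (pathLaw a v T).toMeasure

instance (a : ℕ → ℝ) (v : ℕ → ℕ) (T : ℕ) : IsProbabilityMeasure (law a v T) := by
  unfold law; infer_instance

/-- The number of leaves `x_t` at time `t`. -/
def x (t : ℕ) (ω : Path) : ℕ := (ω t).leaves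

/-- The `σ`-field `Γ_t = σ(x_0, …, x_t)`. -/
abbrev Γ (t : ℕ) : MeasurableSpace Path :=
  MeasurableSpace.comap (fun (ω : Path) (s : Fin (t + 1)) => x s ω) inferInstance

/-- The parameters `a`, replaced by the constant `α` on `[S, T]`. -/
def constOn (a : ℕ → ℝ) (S T : ℕ) (α : ℝ) : ℕ → ℝ :=
  fun t => if S ≤ t ∧ t ≤ T then α else a t

/-- `f_{S,T}(α) = E(x_T ∣ Γ_S)`, computed as if the parameter were equal to `α` on all of `[S, T]`,
and evaluated at the trajectory `ω`. -/
def f (a : ℕ → ℝ) (v : ℕ → ℕ) (S T : ℕ) (α : ℝ) (ω : Path) : ℝ :=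
  ((law (constOn a S T α) v T)[fun ω' => (x T ω' : ℝ) | Γ S]) ω

/-- The set of minimizers of `(f_{S,T}(α) - x_T)²` over the parameter space `α > -1`. -/
def argmin (a : ℕ → ℝ) (v : ℕ → ℕ) (S T : ℕ) (ω : Path) : Set ℝ :=
  {α | -1 < α ∧ IsMinOn (fun β => (f a v S T β ω - (x T ω : ℝ)) ^ 2) (Set.Ioi (-1)) α}

end PrefAttach

end

/-! At time n the degrees add up to 2n+1, so the probability q of choosing a given leaf (`leafProb`)
is deterministic. The conditional mean of the next leaf count is therefore affine in the present
one, with slope 1-q or (1-q)^2 (`expect_leaves_transition`). Iterating, E(x_T | Γ_S) is the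
deterministic recursion `condMean` started at x_S (`condExp_leaves_eq`). Slopes in [0,1] and jumps
of size at most 2 give a mean square deviation of at most 4n (`expect_sq_sub_mean_le`). By
Chebyshev, x_S and x_T are within εT of their means with probability tending to one, and then f(α)
is within εT of M(α), the mean final leaf count when the parameter is α after time S (`splice`).

The rest concerns the recursion. Its value decreases in the parameters and moves by at most four
times their total change (`abs_condMean_sub_le`). Conversely, raising them by a fixed amount during
a positive fraction of the time lowers the mean linearly in T (`exists_mean_gap`): the mean leaf
count is itself of order T (`exists_mul_le_mean`), so each such step creates a gap of constant
order, and since q = O(1/T) away from time 0, a constant fraction of every gap survives to time T.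

Hence f lies above x_T at some α below both true values and below x_T at some α above both;
continuity and strict monotonicity give a unique root. In (a), M(α₁) and M(α₂) differ linearly from
the true mean while f is 4T-Lipschitz, so the root stays away from both. In (b) and (c), M at the
dominant value is within o(T) of the true mean, while a small shift of α changes M linearly, which
traps the root. -/

namespace PrefAttach

/-! ### Expectations under finitely supported laws. -/

section Expectation

variable {β γ : Type*}

/-- The expectation of a real function under a (finitely supported) probability mass function. -/
noncomputable def expect (q : PMF β) (h : β → ℝ) : ℝ := ∑' y, (q y).toReal * h y

theorem expect_eq_sum {q : PMF β} {s : Finset β} (hs : q.support ⊆ s) (h : β → ℝ) :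
    expect q h = ∑ y ∈ s, (q y).toReal * h y := by
  refine tsum_eq_sum fun y hy => ?_
  have : q y = 0 := by
    by_contra h0
    exact hy (by exact_mod_cast hs ((q.mem_support_iff y).2 h0))
  simp [this]

theorem expect_eq_sum_support {q : PMF β} (hq : q.support.Finite) (h : β → ℝ) :
    expect q h = ∑ y ∈ hq.toFinset, (q y).toReal * h y :=
  expect_eq_sum (by simp) h

theorem expect_congr {q : PMF β} {h h' : β → ℝ} (hh : ∀ y ∈ q.support, h y = h' y) :
    expect q h = expect q h' := by
  refine tsum_congr fun y => ?_
  by_cases hy : y ∈ q.support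
  · rw [hh y hy]
  · have : q y = 0 := by simpa [PMF.mem_support_iff] using hy
    simp [this]

theorem expect_mono {q : PMF β} (hq : q.support.Finite) {h h' : β → ℝ}
    (hh : ∀ y ∈ q.support, h y ≤ h' y) : expect q h ≤ expect q h' := by
  rw [expect_eq_sum_support hq, expect_eq_sum_support hq]
  refine Finset.sum_le_sum fun y hy => ?_
  exact mul_le_mul_of_nonneg_left (hh y (by simpa using hy)) ENNReal.toReal_nonneg

theorem expect_const (q : PMF β) (c : ℝ) : expect q (fun _ => c) = c := by
  unfold expect
  rw [tsum_mul_right, ← ENNReal.tsum_toReal_eq (fun y => q.apply_ne_top y), q.tsum_coe]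
  simp

theorem expect_add {q : PMF β} (hq : q.support.Finite) (h h' : β → ℝ) :
    expect q (fun y => h y + h' y) = expect q h + expect q h' := by
  simp only [expect_eq_sum_support hq, mul_add, Finset.sum_add_distrib]

theorem expect_const_mul (q : PMF β) (c : ℝ) (h : β → ℝ) :
    expect q (fun y => c * h y) = c * expect q h := by
  unfold expect
  rw [← tsum_mul_left]
  exact tsum_congr fun y => by ring

theorem expect_sum {q : PMF β} (hq : q.support.Finite) {ι : Type*} (s : Finset ι)
    (h : ι → β → ℝ) : expect q (fun y => ∑ i ∈ s, h i y) = ∑ i ∈ s, expect q (h i) := by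
  simp only [expect_eq_sum_support hq, Finset.mul_sum]
  exact Finset.sum_comm

theorem expect_pure (y : β) (h : β → ℝ) : expect (PMF.pure y) h = h y := by
  classical
  rw [expect_eq_sum (s := {y}) (by simp)]
  simp

theorem finite_support_bind {q : PMF β} {r : β → PMF γ} (hq : q.support.Finite)
    (hr : ∀ y ∈ q.support, (r y).support.Finite) : (q.bind r).support.Finite := by
  rw [PMF.support_bind]
  exact hq.biUnion hr

theorem finite_support_map {q : PMF β} (hq : q.support.Finite) (g : β → γ) :
    (q.map g).support.Finite := by
  rw [PMF.support_map]
  exact hq.image g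

theorem expect_bind {q : PMF β} {r : β → PMF γ} (hq : q.support.Finite)
    (hr : ∀ y ∈ q.support, (r y).support.Finite) (h : γ → ℝ) :
    expect (q.bind r) h = expect q fun y => expect (r y) h := by
  have hb := finite_support_bind hq hr
  rw [expect_eq_sum_support hb, expect_eq_sum_support hq]
  have h1 : ∀ y ∈ hq.toFinset,
      (q y).toReal * expect (r y) h
        = ∑ z ∈ hb.toFinset, (q y).toReal * ((r y z).toReal * h z) := by
    intro y hy
    rw [expect_eq_sum (s := hb.toFinset), Finset.mul_sum]
    intro z hz
    simp only [Set.Finite.coe_toFinset, PMF.support_bind, Set.mem_iUnion]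
    exact ⟨y, by simpa using hy, hz⟩
  rw [Finset.sum_congr rfl h1, Finset.sum_comm]
  refine Finset.sum_congr rfl fun z _ => ?_
  have h2 : (q.bind r) z = ∑ y ∈ hq.toFinset, q y * r y z := by
    rw [PMF.bind_apply]
    refine tsum_eq_sum fun y hy => ?_
    have : q y = 0 := by simpa [PMF.mem_support_iff] using hy
    simp [this]
  rw [h2, ENNReal.toReal_sum fun y _ => ENNReal.mul_ne_top (q.apply_ne_top y)
    ((r y).apply_ne_top z), Finset.sum_mul]
  exact Finset.sum_congr rfl fun y _ => by rw [ENNReal.toReal_mul]; ring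

theorem expect_map {q : PMF β} (hq : q.support.Finite) (g : β → γ) (h : γ → ℝ) :
    expect (q.map g) h = expect q fun y => h (g y) := by
  rw [← PMF.bind_pure_comp, expect_bind hq]
  · simp [expect_pure]
  · simp

end Expectation

/-! ### Degrees, leaves and a single random step. -/

/-- The properties of the graph at time `n` that hold with certainty. -/
structure MGraph.Admissible (g : MGraph) (n : ℕ) : Prop where
  endpoint_lt : ∀ e ∈ g.edges, ∀ u ∈ e, u < g.numV
  numV_pos : 0 < g.numV
  one_le_degree : ∀ u < g.numV, 1 ≤ g.degree u
  sum_degree : ∑ u ∈ Finset.range g.numV, g.degree u = 2 * n + 1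

/-- The vertex numbers `k` and `l` are independent because the degree ignores them; this serves
vertex-steps and edge-steps alike. -/
theorem MGraph.degree_cons (k l : ℕ) (E : Multiset (Sym2 ℕ)) (u w y : ℕ) :
    MGraph.degree ⟨k, s(u, w) ::ₘ E⟩ y
      = MGraph.degree ⟨l, E⟩ y + (if y = u then 1 else 0) + (if y = w then 1 else 0) := by
  have : (s(u, w)).toMultiset.count y = (if y = u then 1 else 0) + (if y = w then 1 else 0) := by
    change Multiset.count y {u, w} = _
    simp only [Multiset.insert_eq_cons, Multiset.count_cons, Multiset.count_singleton]
    omega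
  simp only [MGraph.degree, Multiset.map_cons, Multiset.sum_cons, this]
  omega

theorem MGraph.degree_eq_zero {g : MGraph} {n : ℕ} (hg : g.Admissible n) {y : ℕ}
    (hy : g.numV ≤ y) : g.degree y = 0 := by
  have h0 : y ≠ 0 := by have := hg.numV_pos; omega
  simp only [MGraph.degree, h0, if_false, zero_add]
  rw [Multiset.sum_eq_zero_iff]
  intro c hc
  obtain ⟨e, he, rfl⟩ := Multiset.mem_map.1 hc
  rw [Multiset.count_eq_zero]
  intro hm
  exact absurd (hg.endpoint_lt e he y (by simpa using hm)) (by omega)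

theorem MGraph.admissible_init : MGraph.init.Admissible 0 where
  endpoint_lt := by simp [MGraph.init]
  numV_pos := by simp [MGraph.init]
  one_le_degree := by intro u hu; simp [MGraph.init] at hu; simp [hu, MGraph.degree]
  sum_degree := by simp [MGraph.init, MGraph.degree]

theorem MGraph.Admissible.addVertex {g : MGraph} {n : ℕ} (hg : g.Admissible n) {u : ℕ}
    (hu : u < g.numV) :
    MGraph.Admissible ⟨g.numV + 1, s(u, g.numV) ::ₘ g.edges⟩ (n + 1) where
  endpoint_lt := by
    intro e he y hy
    rcases Multiset.mem_cons.1 he with rfl | he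
    · rcases Sym2.mem_iff.1 hy with rfl | rfl <;> (simp; try omega)
    · have := hg.endpoint_lt e he y hy
      simp; omega
  numV_pos := by simp
  one_le_degree := by
    intro y hy
    rw [MGraph.degree_cons _ g.numV]
    rcases Nat.lt_succ_iff_lt_or_eq.1 hy with hy | rfl
    · have := hg.one_le_degree y hy
      change 1 ≤ g.degree y + _ + _; omega
    · simp
  sum_degree := by
    simp only [MGraph.degree_cons _ g.numV]
    rw [Finset.sum_range_succ, Finset.sum_add_distrib, Finset.sum_add_distrib,
      show (⟨g.numV, g.edges⟩ : MGraph) = g from rfl, hg.sum_degree, MGraph.degree_eq_zero hg le_rfl]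
    have h1 : ∑ y ∈ Finset.range g.numV, (if y = u then 1 else 0) = 1 := by
      simp [Finset.sum_ite_eq', hu]
    have h2 : ∑ y ∈ Finset.range g.numV, (if y = g.numV then 1 else 0) = 0 := by
      simp [Finset.sum_ite_eq']
    rw [h1, h2, if_neg hu.ne']
    simp; ring

theorem MGraph.Admissible.addEdge {g : MGraph} {n : ℕ} (hg : g.Admissible n) {u w : ℕ}
    (hu : u < g.numV) (hw : w < g.numV) :
    MGraph.Admissible ⟨g.numV, s(u, w) ::ₘ g.edges⟩ (n + 1) where
  endpoint_lt := by
    intro e he y hy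
    rcases Multiset.mem_cons.1 he with rfl | he
    · rcases Sym2.mem_iff.1 hy with rfl | rfl <;> simpa
    · exact hg.endpoint_lt e he y hy
  numV_pos := hg.numV_pos
  one_le_degree := by
    intro y hy
    rw [MGraph.degree_cons _ g.numV]
    have := hg.one_le_degree y hy
    change 1 ≤ g.degree y + _ + _; omega
  sum_degree := by
    simp only [MGraph.degree_cons _ g.numV]
    rw [Finset.sum_add_distrib, Finset.sum_add_distrib,
      show (⟨g.numV, g.edges⟩ : MGraph) = g from rfl, hg.sum_degree]
    simp [Finset.sum_ite_eq', hu, hw]; ring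

theorem MGraph.leaves_eq_sum (g : MGraph) :
    (g.leaves : ℝ) = ∑ y ∈ Finset.range g.numV, if g.degree y = 1 then (1 : ℝ) else 0 := by
  rw [MGraph.leaves, Finset.card_filter]
  push_cast
  rfl

/-- Degrees only grow and are at least one, so an old vertex is a leaf afterwards exactly if it was
one and is not chosen; the leading 1 is the new vertex. A sum of indicators is the form to which
linearity of expectation applies. -/
theorem MGraph.leaves_addVertex {g : MGraph} {n : ℕ} (hg : g.Admissible n) {u : ℕ}
    (hu : u < g.numV) :
    ((MGraph.leaves ⟨g.numV + 1, s(u, g.numV) ::ₘ g.edges⟩ : ℕ) : ℝ) = 1 +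
      ∑ y ∈ (Finset.range g.numV).filter fun y => g.degree y = 1, if u = y then (0 : ℝ) else 1 := by
  rw [MGraph.leaves_eq_sum]
  simp only [MGraph.degree_cons _ g.numV, show (⟨g.numV, g.edges⟩ : MGraph) = g from rfl]
  rw [Finset.sum_range_succ, Finset.sum_filter, MGraph.degree_eq_zero hg le_rfl, if_neg hu.ne',
    add_comm]
  simp only [if_true, zero_add]
  congr 1
  refine Finset.sum_congr rfl fun y hy => ?_
  have hy := Finset.mem_range.1 hy
  have h1 := hg.one_le_degree y hy
  rw [if_neg hy.ne]
  by_cases h : u = y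
  · subst h
    rw [if_neg (by simp; omega)]; simp
  · rw [if_neg (Ne.symm h)]; simp [h]

theorem MGraph.leaves_addEdge {g : MGraph} {n : ℕ} (hg : g.Admissible n) {u w : ℕ} :
    ((MGraph.leaves ⟨g.numV, s(u, w) ::ₘ g.edges⟩ : ℕ) : ℝ) =
      ∑ y ∈ (Finset.range g.numV).filter fun y => g.degree y = 1,
        (if u = y then (0 : ℝ) else 1) * (if w = y then (0 : ℝ) else 1) := by
  rw [MGraph.leaves_eq_sum]
  simp only [MGraph.degree_cons _ g.numV, show (⟨g.numV, g.edges⟩ : MGraph) = g from rfl]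
  rw [Finset.sum_filter]
  refine Finset.sum_congr rfl fun y hy => ?_
  have hy := Finset.mem_range.1 hy
  have h1 := hg.one_le_degree y hy
  simp only [eq_comm (a := u), eq_comm (a := w)]
  by_cases h : y = u
  · rw [if_neg (by rw [if_pos h]; omega)]; simp [h]
  · by_cases h' : y = w
    · rw [if_neg (by rw [if_pos h']; omega)]; simp [h']
    · simp [h, h']

/-- The sum of the weights `d(u) + b` of an admissible graph with `k` vertices at time `n`. -/
noncomputable def totalWeight (b : ℝ) (k n : ℕ) : ℝ := 2 * n + 1 + b * k

/-- The total weight depends only on time and on the number of vertices, not on the random shape of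
the graph. This is what makes the leaf count obey a closed recursion in mean. -/
theorem sum_weight {g : MGraph} {n : ℕ} (hg : g.Admissible n) (b : ℝ) :
    ∑ u ∈ Finset.range g.numV, ((g.degree u : ℝ) + b) = totalWeight b g.numV n := by
  rw [Finset.sum_add_distrib, totalWeight, ← Nat.cast_sum, hg.sum_degree]
  simp; ring

theorem degree_add_pos {g : MGraph} {n : ℕ} (hg : g.Admissible n) {b : ℝ} (hb : -1 < b) {u : ℕ}
    (hu : u < g.numV) : 0 < (g.degree u : ℝ) + b := by
  have : (1 : ℝ) ≤ g.degree u := by exact_mod_cast hg.one_le_degree u hu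
  linarith

theorem totalWeight_pos_of_admissible {g : MGraph} {n : ℕ} (hg : g.Admissible n) {b : ℝ}
    (hb : -1 < b) : 0 < totalWeight b g.numV n := by
  rw [← sum_weight hg]
  exact Finset.sum_pos (fun u hu => degree_add_pos hg hb (Finset.mem_range.1 hu))
    ⟨0, Finset.mem_range.2 hg.numV_pos⟩

theorem tsum_weight {g : MGraph} {n : ℕ} (hg : g.Admissible n) {b : ℝ} (hb : -1 < b) :
    ∑' u, weight b g u = ENNReal.ofReal (totalWeight b g.numV n) := by
  rw [tsum_eq_sum (s := Finset.range g.numV) (fun u hu => by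
    simp only [Finset.mem_range] at hu; simp [weight, hu]), ← sum_weight hg,
    ENNReal.ofReal_sum_of_nonneg fun u hu => (degree_add_pos hg hb (Finset.mem_range.1 hu)).le]
  exact Finset.sum_congr rfl fun u hu => by simp [weight, Finset.mem_range.1 hu]

theorem chooseVertex_apply {g : MGraph} {n : ℕ} (hg : g.Admissible n) {b : ℝ} (hb : -1 < b)
    (u : ℕ) : chooseVertex b g u
      = weight b g u * (ENNReal.ofReal (totalWeight b g.numV n))⁻¹ := by
  have h0 : ∑' u, weight b g u ≠ 0 := by
    rw [tsum_weight hg hb]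
    simpa using totalWeight_pos_of_admissible hg hb
  rw [chooseVertex, dif_neg h0, PMF.normalize_apply, tsum_weight hg hb]

theorem support_chooseVertex {g : MGraph} {n : ℕ} (hg : g.Admissible n) {b : ℝ} (hb : -1 < b) :
    (chooseVertex b g).support = {u | u < g.numV} := by
  ext u
  rw [PMF.mem_support_iff, chooseVertex_apply hg hb]
  by_cases hu : u < g.numV
  · simpa [weight, hu] using degree_add_pos hg hb hu
  · simp [weight, hu]

theorem finite_support_chooseVertex {g : MGraph} {n : ℕ} (hg : g.Admissible n) {b : ℝ}
    (hb : -1 < b) : (chooseVertex b g).support.Finite := by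
  rw [support_chooseVertex hg hb]
  exact Set.finite_lt_nat _

/-- The probability with which a given leaf is chosen. -/
noncomputable def leafProb (b : ℝ) (k n : ℕ) : ℝ := (1 + b) / totalWeight b k n

theorem expect_chooseVertex_ne {g : MGraph} {n : ℕ} (hg : g.Admissible n) {b : ℝ} (hb : -1 < b)
    {y : ℕ} (hy : y < g.numV) (hd : g.degree y = 1) :
    expect (chooseVertex b g) (fun u => if u = y then (0 : ℝ) else 1)
      = 1 - leafProb b g.numV n := by
  have h1 : (fun u => if u = y then (0 : ℝ) else 1)
      = fun u => 1 + (-1) * (if u = y then (1 : ℝ) else 0) := by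
    ext u; split_ifs <;> simp
  rw [h1, expect_add (finite_support_chooseVertex hg hb), expect_const, expect_const_mul]
  have h2 : expect (chooseVertex b g) (fun u => if u = y then (1 : ℝ) else 0)
      = leafProb b g.numV n := by
    unfold expect
    rw [tsum_eq_single y (fun u hu => by simp [hu]), chooseVertex_apply hg hb]
    have hW := totalWeight_pos_of_admissible hg hb
    rw [weight, if_pos hy, ENNReal.toReal_mul, ENNReal.toReal_inv,
      ENNReal.toReal_ofReal (degree_add_pos hg hb hy).le, ENNReal.toReal_ofReal hW.le, hd, leafProb]
    simp [div_eq_mul_inv]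
  rw [h2]; ring

/-- The transition law from time `n` to time `n + 1`. -/
noncomputable def transition (v : ℕ → ℕ) (n : ℕ) (b : ℝ) (g : MGraph) : PMF MGraph :=
  if v (n + 1) = v n + 1 then vertexStep b g else edgeStep b g

/-- The conditional mean of the number of leaves after the step from time `n` to time `n + 1`, as a
function of the number of leaves before that step. -/
noncomputable def meanStep (v : ℕ → ℕ) (n : ℕ) (b m : ℝ) : ℝ :=
  if v (n + 1) = v n + 1 then 1 + (1 - leafProb b (v n) n) * m
  else (1 - leafProb b (v n) n) ^ 2 * m

theorem support_vertexStep {g : MGraph} {n : ℕ} (hg : g.Admissible n) {b : ℝ} (hb : -1 < b) :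
    (vertexStep b g).support
      = (fun u => (⟨g.numV + 1, s(u, g.numV) ::ₘ g.edges⟩ : MGraph)) '' {u | u < g.numV} := by
  rw [vertexStep, PMF.support_map, support_chooseVertex hg hb]

theorem support_edgeStep {g : MGraph} {n : ℕ} (hg : g.Admissible n) {b : ℝ} (hb : -1 < b) :
    (edgeStep b g).support
      = ⋃ u ∈ {u | u < g.numV}, (fun w => (⟨g.numV, s(u, w) ::ₘ g.edges⟩ : MGraph)) ''
        {u | u < g.numV} := by
  rw [edgeStep, PMF.support_bind, support_chooseVertex hg hb]
  simp only [PMF.support_map, support_chooseVertex hg hb]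

/-- All degrees are at least one, so all weights are positive for every parameter above -1. An
almost sure identity under a hypothetical parameter can thus be evaluated on data from the true one.
-/
theorem support_transition_eq {v : ℕ → ℕ} {g : MGraph} {n : ℕ} (hg : g.Admissible n) {b b' : ℝ}
    (hb : -1 < b) (hb' : -1 < b') :
    (transition v n b g).support = (transition v n b' g).support := by
  unfold transition
  split_ifs
  · rw [support_vertexStep hg hb, support_vertexStep hg hb']
  · rw [support_edgeStep hg hb, support_edgeStep hg hb']

theorem finite_support_transition {v : ℕ → ℕ} {g : MGraph} {n : ℕ} (hg : g.Admissible n) {b : ℝ}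
    (hb : -1 < b) : (transition v n b g).support.Finite := by
  unfold transition
  split_ifs
  · rw [support_vertexStep hg hb]
    exact (Set.finite_lt_nat _).image _
  · rw [support_edgeStep hg hb]
    exact (Set.finite_lt_nat _).biUnion fun _ _ => (Set.finite_lt_nat _).image _

theorem admissible_of_mem_transition {v : ℕ → ℕ} {g g' : MGraph} {n : ℕ} (hg : g.Admissible n)
    {b : ℝ} (hb : -1 < b) (hv : v (n + 1) = v n ∨ v (n + 1) = v n + 1) (hgv : g.numV = v n)
    (hg' : g' ∈ (transition v n b g).support) :
    g'.Admissible (n + 1) ∧ g'.numV = v (n + 1) := by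
  unfold transition at hg'
  split_ifs at hg' with h
  · rw [support_vertexStep hg hb] at hg'
    obtain ⟨u, hu, rfl⟩ := hg'
    exact ⟨hg.addVertex hu, by simp [h, hgv]⟩
  · rw [support_edgeStep hg hb] at hg'
    simp only [Set.mem_iUnion] at hg'
    obtain ⟨u, hu, w, hw, rfl⟩ := hg'
    exact ⟨hg.addEdge hu hw, by simp [hv.resolve_right h, hgv]⟩

/-- A new edge has two ends, so it destroys at most two leaves, and a step creates at most one. -/
theorem abs_leaves_sub_le {v : ℕ → ℕ} {g g' : MGraph} {n : ℕ} (hg : g.Admissible n)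
    {b : ℝ} (hb : -1 < b) (hg' : g' ∈ (transition v n b g).support) :
    |(g'.leaves : ℝ) - g.leaves| ≤ 2 := by
  have hcard : (g.leaves : ℝ)
      = ∑ y ∈ (Finset.range g.numV).filter fun y => g.degree y = 1, (1 : ℝ) := by
    simp [MGraph.leaves]
  have hone : ∀ u : ℕ, ∑ y ∈ (Finset.range g.numV).filter fun y => g.degree y = 1,
      (if u = y then (1 : ℝ) else 0) ≤ 1 := by
    intro u
    rw [Finset.sum_ite_eq]
    split_ifs <;> norm_num
  have hnn : ∀ u : ℕ, 0 ≤ ∑ y ∈ (Finset.range g.numV).filter fun y => g.degree y = 1,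
      (if u = y then (1 : ℝ) else 0) := fun u =>
    Finset.sum_nonneg fun y _ => by split_ifs <;> norm_num
  unfold transition at hg'
  split_ifs at hg' with h
  · rw [support_vertexStep hg hb] at hg'
    obtain ⟨u, hu, rfl⟩ := hg'
    have h1 : ∑ y ∈ (Finset.range g.numV).filter fun y => g.degree y = 1,
        (if u = y then (0 : ℝ) else 1) = g.leaves -
        ∑ y ∈ (Finset.range g.numV).filter fun y => g.degree y = 1,
          (if u = y then (1 : ℝ) else 0) := by
      rw [hcard, ← Finset.sum_sub_distrib]
      exact Finset.sum_congr rfl fun y _ => by split_ifs <;> norm_num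
    rw [MGraph.leaves_addVertex hg hu, h1, abs_le]
    constructor <;> linarith [hone u, hnn u]
  · rw [support_edgeStep hg hb] at hg'
    simp only [Set.mem_iUnion] at hg'
    obtain ⟨u, hu, w, hw, rfl⟩ := hg'
    rw [MGraph.leaves_addEdge hg, hcard, ← Finset.sum_sub_distrib, abs_le]
    constructor
    · have h2 : -(∑ y ∈ (Finset.range g.numV).filter (fun y => g.degree y = 1),
            (if u = y then (1 : ℝ) else 0)) -
          ∑ y ∈ (Finset.range g.numV).filter (fun y => g.degree y = 1),
            (if w = y then (1 : ℝ) else 0) ≤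
          ∑ y ∈ (Finset.range g.numV).filter (fun y => g.degree y = 1),
            ((if u = y then (0 : ℝ) else 1) * (if w = y then (0 : ℝ) else 1) - 1) := by
        rw [← Finset.sum_neg_distrib, ← Finset.sum_sub_distrib]
        exact Finset.sum_le_sum fun y _ => by split_ifs <;> norm_num
      linarith [hone u, hone w]
    · refine (Finset.sum_nonpos fun y _ => ?_).trans (by norm_num)
      split_ifs <;> norm_num

/-- Linearity over the old leaves: each survives a vertex-step with probability 1-q, and an
edge-step with probability (1-q)^2 because the two ends are independent. -/
theorem expect_leaves_transition {v : ℕ → ℕ} {g : MGraph} {n : ℕ} (hg : g.Admissible n)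
    {b : ℝ} (hb : -1 < b) (hgv : g.numV = v n) :
    expect (transition v n b g) (fun g' => (g'.leaves : ℝ)) = meanStep v n b g.leaves := by
  have hfin := finite_support_chooseVertex hg hb
  have hE : ∀ y ∈ (Finset.range g.numV).filter fun y => g.degree y = 1,
      expect (chooseVertex b g) (fun u => if u = y then (0 : ℝ) else 1)
        = 1 - leafProb b (v n) n := by
    intro y hy
    simp only [Finset.mem_filter, Finset.mem_range] at hy
    rw [expect_chooseVertex_ne hg hb hy.1 hy.2, hgv]
  unfold transition meanStep
  split_ifs with h
  · rw [vertexStep, expect_map hfin, expect_congr (h' := fun u => 1 +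
      ∑ y ∈ (Finset.range g.numV).filter (fun y => g.degree y = 1), if u = y then (0 : ℝ) else 1)]
    · rw [expect_add hfin, expect_const, expect_sum hfin, Finset.sum_congr rfl hE]
      simp only [Finset.sum_const, nsmul_eq_mul, MGraph.leaves, mul_comm]
    · intro u hu
      rw [support_chooseVertex hg hb] at hu
      exact MGraph.leaves_addVertex hg hu
  · rw [edgeStep, expect_bind hfin fun u _ => finite_support_map hfin _]
    simp only [expect_map hfin, MGraph.leaves_addEdge hg]
    simp only [expect_sum hfin, expect_const_mul]
    rw [Finset.sum_congr rfl (g := fun _ => (1 - leafProb b (v n) n) ^ 2)]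
    · simp [MGraph.leaves, mul_comm]
    · intro y hy
      rw [hE y hy]
      simp only [mul_comm _ (1 - leafProb b (v n) n), expect_const_mul, hE y hy]
      ring

/-! ### Vertex counts and bounds on the leaf probability. -/

/-- Vertex counts that start at one and grow by at most one per step. -/
structure IsCounts (v : ℕ → ℕ) : Prop where
  zero : v 0 = 1
  step : ∀ t, v (t + 1) = v t ∨ v (t + 1) = v t + 1

theorem IsCounts.one_le {v : ℕ → ℕ} (hv : IsCounts v) (n : ℕ) : 1 ≤ v n := by
  induction n with
  | zero => exact hv.zero.ge
  | succ n ih => rcases hv.step n with h | h <;> omega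

theorem IsCounts.le_succ {v : ℕ → ℕ} (hv : IsCounts v) (n : ℕ) : v n ≤ n + 1 := by
  induction n with
  | zero => exact hv.zero.le
  | succ n ih => rcases hv.step n with h | h <;> omega

theorem IsCounts.one_le_cast {v : ℕ → ℕ} (hv : IsCounts v) (n : ℕ) : (1 : ℝ) ≤ v n := by
  exact_mod_cast hv.one_le n

theorem IsCounts.cast_le_succ {v : ℕ → ℕ} (hv : IsCounts v) (n : ℕ) : (v n : ℝ) ≤ n + 1 := by
  exact_mod_cast hv.le_succ n

/-- Both summands are nonnegative for `k = v n ≤ n + 1` and `b > -1`; the bounds on the total weight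
are read off from this splitting. -/
theorem totalWeight_eq (b : ℝ) (k n : ℕ) :
    totalWeight b k n = (2 * n + 1 - k) + (1 + b) * k := by
  rw [totalWeight]; ring

section Bounds

variable {v : ℕ → ℕ} (hv : IsCounts v) {b : ℝ} (hb : -1 < b) (n : ℕ)

include hv in
theorem mul_le_totalWeight (b : ℝ) : (1 + b) * v n ≤ totalWeight b (v n) n := by
  rw [totalWeight_eq]
  have := hv.cast_le_succ n
  have : (0 : ℝ) ≤ n := n.cast_nonneg
  linarith

include hv hb

theorem totalWeight_pos : 0 < totalWeight b (v n) n :=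
  lt_of_lt_of_le (mul_pos (by linarith) (by linarith [hv.one_le_cast n]))
    (mul_le_totalWeight hv n b)

theorem le_totalWeight : (n : ℝ) ≤ totalWeight b (v n) n := by
  rw [totalWeight_eq]
  have := hv.cast_le_succ n
  have : 0 ≤ (1 + b) * v n := mul_nonneg (by linarith) (by positivity)
  linarith

theorem leafProb_nonneg : 0 ≤ leafProb b (v n) n :=
  div_nonneg (by linarith) (totalWeight_pos hv hb n).le

/-- The bound is free of `b`, which makes later estimates uniform in the parameters. -/
theorem leafProb_le_inv : leafProb b (v n) n ≤ 1 / v n := by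
  have h1 := hv.one_le_cast n
  rw [leafProb, div_le_div_iff₀ (totalWeight_pos hv hb n) (by linarith), one_mul]
  exact mul_le_totalWeight hv n b

theorem leafProb_le_one : leafProb b (v n) n ≤ 1 := by
  refine (leafProb_le_inv hv hb n).trans ?_
  rw [div_le_one (by linarith [hv.one_le_cast n])]
  exact hv.one_le_cast n

theorem exists_meanStep_eq :
    ∃ c r : ℝ, 0 ≤ r ∧ r ≤ 1 ∧ ∀ m, meanStep v n b m = c + r * m := by
  have h0 := leafProb_nonneg hv hb n
  have h1 := leafProb_le_one hv hb n
  unfold meanStep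
  split_ifs with h
  · exact ⟨1, _, by linarith, by linarith, fun m => rfl⟩
  · exact ⟨0, _, sq_nonneg _, pow_le_one₀ (by linarith) (by linarith), fun m => (zero_add _).symm⟩

end Bounds

/-! ### The mean recursion and the trajectories. -/

/-- The mean number of leaves at time `n`, given that it is `y` at time `S`. -/
noncomputable def condMean (v : ℕ → ℕ) (b : ℕ → ℝ) (S : ℕ) (y : ℝ) : ℕ → ℝ
  | 0 => y
  | n + 1 => if n < S then y else meanStep v n (b (n + 1)) (condMean v b S y n)

theorem condMean_of_le (v : ℕ → ℕ) (b : ℕ → ℝ) {S n : ℕ} (y : ℝ) (h : n ≤ S) :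
    condMean v b S y n = y := by
  cases n with
  | zero => rfl
  | succ n => rw [condMean, if_pos (Nat.lt_of_succ_le h)]

theorem condMean_succ (v : ℕ → ℕ) (b : ℕ → ℝ) {S n : ℕ} (y : ℝ) (h : S ≤ n) :
    condMean v b S y (n + 1) = meanStep v n (b (n + 1)) (condMean v b S y n) := by
  rw [condMean, if_neg h.not_gt]

/-- The mean number of leaves. -/
noncomputable def mean (v : ℕ → ℕ) (b : ℕ → ℝ) (n : ℕ) : ℝ := condMean v b 0 1 n

theorem mean_zero (v : ℕ → ℕ) (b : ℕ → ℝ) : mean v b 0 = 1 := rfl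

theorem mean_succ (v : ℕ → ℕ) (b : ℕ → ℝ) (n : ℕ) :
    mean v b (n + 1) = meanStep v n (b (n + 1)) (mean v b n) :=
  condMean_succ v b 1 n.zero_le

/-- The trajectory that follows `ω` up to time `n` and is equal to `g` afterwards. -/
def extend (ω : Path) (n : ℕ) (g : MGraph) : Path := fun s => if s ≤ n then ω s else g

theorem extend_of_le (ω : Path) {n s : ℕ} (g : MGraph) (h : s ≤ n) : extend ω n g s = ω s :=
  if_pos h

theorem extend_succ (ω : Path) (n : ℕ) (g : MGraph) : extend ω n g (n + 1) = g :=
  if_neg (by omega)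

/-- The constant trajectory at the initial graph. -/
def initPath : Path := fun _ => MGraph.init

theorem pathLaw_zero (a : ℕ → ℝ) (v : ℕ → ℕ) : pathLaw a v 0 = PMF.pure initPath := rfl

theorem pathLaw_succ (a : ℕ → ℝ) (v : ℕ → ℕ) (n : ℕ) : pathLaw a v (n + 1)
    = (pathLaw a v n).bind fun ω => (transition v n (a (n + 1)) (ω n)).map (extend ω n) := rfl

/-! ### First and second moments of the leaf count. -/

section PathLaw

variable {a : ℕ → ℝ} (ha : ∀ t, -1 < a t) {v : ℕ → ℕ} (hv : IsCounts v)
include ha hv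

theorem admissible_of_mem_support {n : ℕ} {ω : Path} (hω : ω ∈ (pathLaw a v n).support) :
    (ω n).Admissible n ∧ (ω n).numV = v n := by
  induction n generalizing ω with
  | zero =>
    obtain rfl : ω = initPath := by simpa [pathLaw_zero] using hω
    exact ⟨MGraph.admissible_init, hv.zero.symm⟩
  | succ n ih =>
    simp only [pathLaw_succ, PMF.support_bind, PMF.support_map, Set.mem_iUnion] at hω
    obtain ⟨ω', hω', g, hg, rfl⟩ := hω
    rw [extend_succ]
    exact admissible_of_mem_transition (ih hω').1 (ha _) (hv.step n) (ih hω').2 hg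

theorem finite_support_pathLaw (n : ℕ) : (pathLaw a v n).support.Finite := by
  induction n with
  | zero => simp [pathLaw_zero]
  | succ n ih =>
    rw [pathLaw_succ]
    exact finite_support_bind ih fun ω hω => finite_support_map
      (finite_support_transition (admissible_of_mem_support ha hv hω).1 (ha _)) _

theorem support_pathLaw_eq {a' : ℕ → ℝ} (ha' : ∀ t, -1 < a' t) (n : ℕ) :
    (pathLaw a v n).support = (pathLaw a' v n).support := by
  induction n with
  | zero => rfl
  | succ n ih =>
    simp only [pathLaw_succ, PMF.support_bind, PMF.support_map]
    rw [← ih]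
    refine Set.iUnion₂_congr fun ω hω => ?_
    rw [support_transition_eq (admissible_of_mem_support ha hv hω).1 (ha _) (ha' _)]

theorem expect_pathLaw_succ (n : ℕ) (h : Path → ℝ) : expect (pathLaw a v (n + 1)) h
    = expect (pathLaw a v n) fun ω =>
      expect (transition v n (a (n + 1)) (ω n)) fun g => h (extend ω n g) := by
  have hfin := finite_support_pathLaw ha hv n
  have hfin' : ∀ ω ∈ (pathLaw a v n).support,
      (transition v n (a (n + 1)) (ω n)).support.Finite := fun ω hω =>
    finite_support_transition (admissible_of_mem_support ha hv hω).1 (ha _)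
  rw [pathLaw_succ, expect_bind hfin fun ω hω => finite_support_map (hfin' ω hω) _]
  exact expect_congr fun ω hω => expect_map (hfin' ω hω) _ _

theorem expect_pathLaw_eq {S n : ℕ} (hSn : S ≤ n) {h : Path → ℝ}
    (hh : ∀ ω ω' : Path, (∀ t ≤ S, ω t = ω' t) → h ω = h ω') :
    expect (pathLaw a v n) h = expect (pathLaw a v S) h := by
  induction n, hSn using Nat.le_induction with
  | base => rfl
  | succ n hn ih =>
    rw [expect_pathLaw_succ ha hv, ← ih]
    congr 1
    ext ω
    rw [← expect_const (transition v n (a (n + 1)) (ω n)) (h ω)]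
    congr 1
    ext g
    exact hh _ _ fun t ht => extend_of_le ω g (ht.trans hn)

/-- The defining property of E(x_n | Γ_S), tested against any function of the trajectory up to time
`S`. The induction works because each step acts on the leaf count by an affine map, which passes
through the expectation. -/
theorem expect_mul_leaves {S n : ℕ} (hSn : S ≤ n) {h : Path → ℝ}
    (hh : ∀ ω ω' : Path, (∀ t ≤ S, ω t = ω' t) → h ω = h ω') :
    expect (pathLaw a v n) (fun ω => h ω * x n ω)
      = expect (pathLaw a v n) fun ω => h ω * condMean v a S (x S ω) n := by
  induction n, hSn using Nat.le_induction with
  | base => simp only [condMean_of_le v a _ le_rfl]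
  | succ n hn ih =>
    obtain ⟨c, r, -, -, hcr⟩ := exists_meanStep_eq hv (ha (n + 1)) n
    have hfin := finite_support_pathLaw ha hv n
    have h1 : expect (pathLaw a v (n + 1)) (fun ω => h ω * x (n + 1) ω)
        = expect (pathLaw a v n) fun ω => c * h ω + r * (h ω * x n ω) := by
      rw [expect_pathLaw_succ ha hv]
      refine expect_congr fun ω hω => ?_
      obtain ⟨hg, hgv⟩ := admissible_of_mem_support ha hv hω
      have h2 : ∀ g, h (extend ω n g) * x (n + 1) (extend ω n g) = h ω * (g.leaves : ℝ) := by
        intro g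
        rw [hh _ ω fun t ht => extend_of_le ω g (ht.trans hn), x, extend_succ]
      simp only [h2]
      rw [expect_const_mul, expect_leaves_transition hg (ha _) hgv, hcr, x]
      ring
    have h3 : expect (pathLaw a v (n + 1)) (fun ω => h ω * condMean v a S (x S ω) (n + 1))
        = expect (pathLaw a v n) fun ω => c * h ω + r * (h ω * condMean v a S (x S ω) n) := by
      have hdep : ∀ m k, S ≤ m → expect (pathLaw a v m) (fun ω => h ω * condMean v a S (x S ω) k)
          = expect (pathLaw a v S) (fun ω => h ω * condMean v a S (x S ω) k) := fun m k hm =>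
        expect_pathLaw_eq ha hv hm fun ω ω' hω => by rw [hh ω ω' hω, x, x, hω S le_rfl]
      rw [hdep _ _ (by omega), ← hdep n _ hn]
      congr 1
      ext ω
      rw [condMean_succ v a _ hn, hcr]
      ring
    rw [h1, h3, expect_add hfin, expect_add hfin, expect_const_mul _ r, expect_const_mul _ r, ih]

/-- A step adds a conditional variance of at most 4, and the slope in [0,1] does not enlarge the
deviation already present. -/
theorem expect_sq_sub_mean_le (n : ℕ) :
    expect (pathLaw a v n) (fun ω => ((x n ω : ℝ) - mean v a n) ^ 2) ≤ 4 * n := by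
  induction n with
  | zero =>
    rw [pathLaw_zero, expect_pure]
    simp [x, initPath, MGraph.leaves, MGraph.init, MGraph.degree, mean_zero]
  | succ n ih =>
    have hfin := finite_support_pathLaw ha hv n
    obtain ⟨c, r, hr0, hr1, hcr⟩ := exists_meanStep_eq hv (ha (n + 1)) n
    have h1 : expect (pathLaw a v (n + 1))
          (fun ω => ((x (n + 1) ω : ℝ) - mean v a (n + 1)) ^ 2)
        ≤ expect (pathLaw a v n) fun ω => 4 + ((x n ω : ℝ) - mean v a n) ^ 2 := by
      rw [expect_pathLaw_succ ha hv]
      refine expect_mono hfin fun ω hω => ?_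
      obtain ⟨hg, hgv⟩ := admissible_of_mem_support ha hv hω
      have hft := finite_support_transition (v := v) hg (ha (n + 1))
      have hE := expect_leaves_transition hg (ha (n + 1)) hgv
      rw [hcr] at hE
      simp only [x, extend_succ]
      have hμ : mean v a (n + 1) = c + r * mean v a n := by rw [mean_succ, hcr]
      set y : ℝ := ((ω n).leaves : ℝ)
      set μ := mean v a n
      rw [hμ]
      -- The square is expanded around the old count `y`: the squared jump is at most 4, and the
      -- remainder is affine in the new count.
      calc expect (transition v n (a (n + 1)) (ω n))
            (fun g => ((g.leaves : ℝ) - (c + r * μ)) ^ 2)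
          ≤ expect (transition v n (a (n + 1)) (ω n)) (fun g =>
            (4 + (y - (c + r * μ)) ^ 2 - 2 * (y - (c + r * μ)) * y)
              + (2 * (y - (c + r * μ))) * g.leaves) := by
            refine expect_mono hft fun g hg' => ?_
            have h2 := sq_le_sq' (neg_le_of_abs_le (abs_leaves_sub_le hg (ha _) hg'))
              (le_of_abs_le (abs_leaves_sub_le hg (ha _) hg'))
            nlinarith [h2]
        _ = 4 + (r * (y - μ)) ^ 2 - (c + r * y - y) ^ 2 := by
            rw [expect_add hft, expect_const, expect_const_mul, hE]
            ring
        _ ≤ 4 + (y - μ) ^ 2 := by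
            have : r ^ 2 ≤ 1 := pow_le_one₀ hr0 hr1
            nlinarith [sq_nonneg (c + r * y - y), sq_nonneg (y - μ)]
    refine h1.trans ?_
    rw [expect_add hfin, expect_const]
    push_cast
    linarith

end PathLaw

/-! ### Conditional expectation and concentration. -/

instance : MeasurableSingletonClass Path := ⟨fun _ => MeasurableSpace.measurableSet_top⟩

theorem measurableSet_path (s : Set Path) : MeasurableSet s := MeasurableSpace.measurableSet_top

theorem measurable_path {β : Type*} [MeasurableSpace β] (h : Path → β) : Measurable h :=
  fun _ _ => measurableSet_path _

theorem integrable_toMeasure {q : PMF Path} (hq : q.support.Finite) (h : Path → ℝ) :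
    Integrable h q.toMeasure := by
  refine Integrable.of_bound (measurable_path h).aestronglyMeasurable
    (∑ ω ∈ hq.toFinset, ‖h ω‖) ?_
  rw [ae_iff, PMF.toMeasure_apply_eq_zero_iff _ (measurableSet_path _), Set.disjoint_left]
  intro ω hω
  simp only [Set.mem_ofPred_eq, not_not]
  exact Finset.single_le_sum (f := fun ω => ‖h ω‖) (fun _ _ => norm_nonneg _) (by simpa using hω)

theorem integral_toMeasure {q : PMF Path} (hq : q.support.Finite) (h : Path → ℝ) :
    ∫ ω, h ω ∂q.toMeasure = expect q h := by
  rw [PMF.integral_eq_tsum _ _ (integrable_toMeasure hq h)]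
  rfl

theorem setIntegral_toMeasure {q : PMF Path} (hq : q.support.Finite) (h : Path → ℝ)
    (s : Set Path) :
    ∫ ω in s, h ω ∂q.toMeasure = expect q fun ω => s.indicator (fun _ => (1 : ℝ)) ω * h ω := by
  rw [← integral_indicator (measurableSet_path s), integral_toMeasure hq]
  congr 1
  ext ω
  by_cases hω : ω ∈ s <;> simp [hω]

theorem toReal_toMeasure {q : PMF Path} (hq : q.support.Finite) (s : Set Path) :
    (q.toMeasure s).toReal = expect q (s.indicator fun _ => (1 : ℝ)) := by
  rw [← integral_toMeasure hq, integral_indicator_const _ (measurableSet_path s)]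
  simp [Measure.real]

/-- The conditional mean of the final number of leaves, given the numbers of leaves up to time
`S`, depends only on the number of leaves at time `S`. -/
theorem condExp_leaves_eq {a : ℕ → ℝ} (ha : ∀ t, -1 < a t) {v : ℕ → ℕ} (hv : IsCounts v)
    {S T : ℕ} (hST : S ≤ T) {ω : Path} (hω : ω ∈ (pathLaw a v T).support) :
    ((law a v T)[fun ω' => (x T ω' : ℝ) | Γ S]) ω = condMean v a S (x S ω) T := by
  have hfin := finite_support_pathLaw ha hv T
  have hle : Γ S ≤ (inferInstance : MeasurableSpace Path) := le_top
  have hx : Measurable[Γ S] fun ω : Path => x S ω := by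
    have h1 : Measurable[Γ S] fun (ω : Path) (s : Fin (S + 1)) => x s ω :=
      comap_measurable _
    exact (measurable_pi_apply (Fin.last S)).comp h1
  have hae : (fun ω : Path => condMean v a S (x S ω) T)
      =ᵐ[law a v T] (law a v T)[fun ω' => (x T ω' : ℝ) | Γ S] := by
    refine ae_eq_condExp_of_forall_setIntegral_eq hle (integrable_toMeasure hfin _)
      (fun s _ _ => (integrable_toMeasure hfin _).integrableOn) ?_ ?_
    · rintro s ⟨t, -, rfl⟩ -
      unfold law
      rw [setIntegral_toMeasure hfin, setIntegral_toMeasure hfin]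
      -- The indicator of a set in Γ_S is a function of the trajectory up to time `S`, hence an
      -- admissible test function.
      refine (expect_mul_leaves ha hv hST fun ω ω' h => ?_).symm
      have h2 : (fun s : Fin (S + 1) => x s ω) = fun s : Fin (S + 1) => x s ω' := by
        ext s
        rw [x, x, h s (by omega)]
      have h3 : ω ∈ (fun (ω : Path) (s : Fin (S + 1)) => x s ω) ⁻¹' t
          ↔ ω' ∈ (fun (ω : Path) (s : Fin (S + 1)) => x s ω) ⁻¹' t := by
        rw [Set.mem_preimage, Set.mem_preimage, h2]
      by_cases h4 : ω ∈ (fun (ω : Path) (s : Fin (S + 1)) => x s ω) ⁻¹' t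
      · rw [Set.indicator_of_mem h4, Set.indicator_of_mem (h3.1 h4)]
      · rw [Set.indicator_of_notMem h4, Set.indicator_of_notMem (mt h3.2 h4)]
    · have h3 : Measurable fun k : ℕ => condMean v a S (k : ℝ) T := measurable_from_top
      exact (h3.comp hx).stronglyMeasurable.aestronglyMeasurable
  -- A null set contains no trajectory of the support, so the almost sure identity holds at `ω`
  -- itself.
  rw [Filter.EventuallyEq, ae_iff, law,
    PMF.toMeasure_apply_eq_zero_iff _ (measurableSet_path _), Set.disjoint_left] at hae
  have := hae hω
  simp only [Set.mem_ofPred_eq, not_not] at this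
  exact this.symm

/-- An event that occurs whenever the numbers of leaves at the times `S` and `T` are sufficiently
close to their means has probability tending to one. -/
theorem tendsto_law_of_close {v : ℕ → ℕ → ℕ} (hv : ∀ T, IsCounts (v T)) {a : ℕ → ℕ → ℝ}
    (ha : ∀ T t, -1 < a T t) {S : ℕ → ℕ} (hS : ∀ᶠ T in atTop, S T ≤ T) (A : ℕ → Set Path) {ε : ℝ}
    (hε : 0 < ε) (hA : ∀ᶠ T : ℕ in atTop, ∀ ω ∈ (pathLaw (a T) (v T) T).support,
      |(x (S T) ω : ℝ) - mean (v T) (a T) (S T)| ≤ ε * T →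
      |(x T ω : ℝ) - mean (v T) (a T) T| ≤ ε * T → ω ∈ A T) :
    Tendsto (fun T => law (a T) (v T) T (A T)) atTop (𝓝 1) := by
  have hbound : ∀ᶠ T : ℕ in atTop,
      1 - 8 / ε ^ 2 * (T : ℝ)⁻¹ ≤ (law (a T) (v T) T (A T)).toReal := by
    filter_upwards [hS, hA, eventually_gt_atTop 0] with T hST hAT hT
    have hT' : (0 : ℝ) < T := by exact_mod_cast hT
    have hfin := finite_support_pathLaw (ha T) (hv T) T
    have hsq : ∀ n ≤ T, expect (pathLaw (a T) (v T) T)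
        (fun ω => ((x n ω : ℝ) - mean (v T) (a T) n) ^ 2) ≤ 4 * T := by
      intro n hn
      rw [expect_pathLaw_eq (ha T) (hv T) hn fun ω ω' h => by rw [x, x, h n le_rfl]]
      refine (expect_sq_sub_mean_le (ha T) (hv T) n).trans ?_
      have : (n : ℝ) ≤ T := by exact_mod_cast hn
      linarith
    rw [law, toReal_toMeasure hfin]
    set N : ℝ := (ε * T) ^ 2
    have hN : 0 < N := by positivity
    -- Chebyshev for both times at once: the indicator of `A T` is at least one minus the two
    -- squared deviations over `N`, and each of these squares has mean at most 4T.
    calc 1 - 8 / ε ^ 2 * (T : ℝ)⁻¹ = 1 + -N⁻¹ * (4 * T + 4 * T) := by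
          simp only [N]; field_simp; ring
      _ ≤ 1 + -N⁻¹ * (expect (pathLaw (a T) (v T) T)
              (fun ω => ((x (S T) ω : ℝ) - mean (v T) (a T) (S T)) ^ 2)
            + expect (pathLaw (a T) (v T) T)
              (fun ω => ((x T ω : ℝ) - mean (v T) (a T) T) ^ 2)) := by
          rw [neg_mul, neg_mul]
          gcongr
          · exact hsq _ hST
          · exact hsq _ le_rfl
      _ = expect (pathLaw (a T) (v T) T) (fun ω => 1 + -N⁻¹ *
            (((x (S T) ω : ℝ) - mean (v T) (a T) (S T)) ^ 2
              + ((x T ω : ℝ) - mean (v T) (a T) T) ^ 2)) := by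
          rw [expect_add hfin, expect_const, expect_const_mul, expect_add hfin]
      _ ≤ _ := by
          refine expect_mono hfin fun ω hω => ?_
          have key : ∀ z : ℝ, ¬ |z| ≤ ε * T → 1 ≤ N⁻¹ * z ^ 2 := by
            intro z hz
            rw [inv_mul_eq_div, one_le_div hN, ← sq_abs z]
            exact pow_le_pow_left₀ (by positivity) (not_le.1 hz).le 2
          have hnn : ∀ z : ℝ, 0 ≤ N⁻¹ * z ^ 2 := fun z => by positivity
          have h1 := hnn ((x (S T) ω : ℝ) - mean (v T) (a T) (S T))
          have h2 := hnn ((x T ω : ℝ) - mean (v T) (a T) T)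
          by_cases hωA : ω ∈ A T
          · rw [Set.indicator_of_mem hωA]
            linarith
          · rw [Set.indicator_of_notMem hωA]
            by_cases h3 : |(x (S T) ω : ℝ) - mean (v T) (a T) (S T)| ≤ ε * T
            · by_cases h4 : |(x T ω : ℝ) - mean (v T) (a T) T| ≤ ε * T
              · exact absurd (hAT ω hω h3 h4) hωA
              · linarith [key _ h4]
            · linarith [key _ h3]
  have hreal : Tendsto (fun T => (law (a T) (v T) T (A T)).toReal) atTop (𝓝 1) := by
    refine tendsto_of_tendsto_of_tendsto_of_le_of_le' (g := fun T : ℕ => 1 - 8 / ε ^ 2 * (T : ℝ)⁻¹)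
      (h := fun _ => 1) ?_ tendsto_const_nhds hbound (Eventually.of_forall fun T => ?_)
    · have h := (tendsto_inv_atTop_nhds_zero_nat (𝕜 := ℝ)).const_mul (8 / ε ^ 2)
      simpa using h.const_sub 1
    · exact ENNReal.toReal_le_of_le_ofReal zero_le_one (by simpa using prob_le_one)
  have h := (ENNReal.continuous_ofReal.tendsto 1).comp hreal
  simp only [ENNReal.ofReal_one] at h
  refine h.congr fun T => ?_
  exact ENNReal.ofReal_toReal (measure_ne_top _ _)

theorem x_le {a : ℕ → ℝ} (ha : ∀ t, -1 < a t) {v : ℕ → ℕ} (hv : IsCounts v) {n t : ℕ}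
    (ht : t ≤ n) {ω : Path} (hω : ω ∈ (pathLaw a v n).support) : x t ω ≤ v t := by
  have hle : ∀ k (ω : Path), ω ∈ (pathLaw a v k).support → x k ω ≤ v k := by
    intro k ω hω
    rw [← (admissible_of_mem_support ha hv hω).2, x, MGraph.leaves]
    exact (Finset.card_filter_le _ _).trans (by simp)
  induction n, ht using Nat.le_induction generalizing ω with
  | base => exact hle _ _ hω
  | succ n hn ih =>
    simp only [pathLaw_succ, PMF.support_bind, PMF.support_map, Set.mem_iUnion] at hω
    obtain ⟨ω', hω', g, hg, rfl⟩ := hω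
    rw [x, extend_of_le _ _ hn]
    exact ih hω'

theorem IsCounts.le_two_mul_sub {v : ℕ → ℕ} (hv : IsCounts v) (n : ℕ) :
    (n : ℝ) ≤ 2 * n + 1 - v n := by
  linarith [hv.cast_le_succ n]

/-! ### Dependence of the leaf probability on the parameter. -/

section LeafProb

variable {v : ℕ → ℕ} (hv : IsCounts v) {b b' : ℝ} (hb : -1 < b) (hb' : -1 < b') (n : ℕ)
include hv hb hb'

theorem leafProb_sub : leafProb b' (v n) n - leafProb b (v n) n
    = (b' - b) * (2 * n + 1 - v n) / (totalWeight b (v n) n * totalWeight b' (v n) n) := by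
  have h := (totalWeight_pos hv hb n).ne'
  have h' := (totalWeight_pos hv hb' n).ne'
  rw [leafProb, leafProb, div_sub_div _ _ h' h]
  congr 1
  · rw [totalWeight, totalWeight]
    ring
  · ring

theorem leafProb_mono (hbb : b ≤ b') : leafProb b (v n) n ≤ leafProb b' (v n) n := by
  rw [← sub_nonneg, leafProb_sub hv hb hb']
  have h := totalWeight_pos hv hb n
  have h' := totalWeight_pos hv hb' n
  have h1 := hv.le_two_mul_sub n
  have h2 : (0 : ℝ) ≤ n := n.cast_nonneg
  exact div_nonneg (mul_nonneg (by linarith) (by linarith)) (by positivity)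

/-- Time 0 is excluded: the only vertex is then chosen with certainty, whatever the parameter. -/
theorem leafProb_strictMono (hbb : b < b') (hn : 0 < n) :
    leafProb b (v n) n < leafProb b' (v n) n := by
  rw [← sub_pos, leafProb_sub hv hb hb']
  have h := totalWeight_pos hv hb n
  have h' := totalWeight_pos hv hb' n
  have h1 := hv.le_two_mul_sub n
  have h2 : (0 : ℝ) < n := by exact_mod_cast hn
  exact div_pos (mul_pos (by linarith) (by linarith)) (by positivity)

theorem le_leafProb_sub (hbb : b ≤ b') (hn : 0 < n) {B : ℝ} (hB : b' ≤ B) :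
    (b' - b) / ((5 + 2 * B) ^ 2 * n) ≤ leafProb b' (v n) n - leafProb b (v n) n := by
  have hn' : (1 : ℝ) ≤ n := by exact_mod_cast hn
  have h := totalWeight_pos hv hb n
  have h' := totalWeight_pos hv hb' n
  have h1 := hv.le_two_mul_sub n
  have hle : ∀ c, -1 < c → c ≤ B → totalWeight c (v n) n ≤ (5 + 2 * B) * n := by
    intro c hc hcB
    have h3 : (1 + c) * v n ≤ (1 + B) * (2 * n) :=
      mul_le_mul (by linarith) (by linarith [hv.cast_le_succ n]) (by positivity) (by linarith)
    rw [totalWeight_eq]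
    linarith [hv.one_le_cast n]
  rw [leafProb_sub hv hb hb']
  have h2 : 0 < 5 + 2 * B := by linarith
  calc (b' - b) / ((5 + 2 * B) ^ 2 * n)
      = (b' - b) * n / (((5 + 2 * B) * n) * ((5 + 2 * B) * n)) := by field_simp
    _ ≤ _ := by
      gcongr
      · exact mul_nonneg (by linarith) (by linarith)
      · exact hle b hb (by linarith)
      · exact hle b' hb' hB

/-- In the numerator of `leafProb_sub`, 2n+1-v is at most one total weight and v at most twice the
other. The Lipschitz constant therefore does not blow up as the parameters approach -1. -/
theorem mul_abs_leafProb_sub_le :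
    v n * |leafProb b' (v n) n - leafProb b (v n) n| ≤ 2 * |b' - b| := by
  wlog hbb : b ≤ b' generalizing b b'
  · rw [abs_sub_comm, abs_sub_comm b']
    exact this hb' hb (by linarith)
  rw [abs_of_nonneg (by linarith [leafProb_mono hv hb hb' n hbb]), abs_of_nonneg (by linarith),
    leafProb_sub hv hb hb']
  have h := totalWeight_pos hv hb n
  have h' := totalWeight_pos hv hb' n
  rw [mul_div_assoc', div_le_iff₀ (by positivity)]
  -- At time 0 the bound of v by twice the total weight can fail, but there 2n+1-v vanishes.
  rcases Nat.eq_zero_or_pos n with rfl | hn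
  · have : (2 * ((0 : ℕ) : ℝ) + 1 - v 0) = 0 := by simp [hv.zero]
    rw [this, mul_zero, mul_zero]
    exact mul_nonneg (by linarith) (by positivity)
  have hn' : (1 : ℝ) ≤ n := by exact_mod_cast hn
  have h1 := hv.le_two_mul_sub n
  have h2 : 2 * (n : ℝ) + 1 - v n ≤ totalWeight b (v n) n := by
    rw [totalWeight_eq]
    have : 0 ≤ (1 + b) * v n := mul_nonneg (by linarith) (by positivity)
    linarith
  have h3 : (v n : ℝ) ≤ 2 * totalWeight b' (v n) n := by
    linarith [le_totalWeight hv hb' n, hv.cast_le_succ n]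
  have h4 : (v n : ℝ) * (2 * n + 1 - v n)
      ≤ 2 * totalWeight b' (v n) n * totalWeight b (v n) n :=
    mul_le_mul h3 h2 (by linarith) (by positivity)
  nlinarith [h4, sub_nonneg.2 hbb]

end LeafProb

/-! ### One step of the mean recursion under two parameters. -/

section MeanStep

variable {v : ℕ → ℕ} (hv : IsCounts v) (n : ℕ)
include hv

theorem meanStep_nonneg {b m : ℝ} (hb : -1 < b) (hm : 0 ≤ m) : 0 ≤ meanStep v n b m := by
  have h1 := leafProb_le_one hv hb n
  unfold meanStep
  split_ifs
  · have := mul_nonneg (sub_nonneg.2 h1) hm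
    linarith
  · positivity

theorem meanStep_le {b m : ℝ} (hb : -1 < b) (hm : 0 ≤ m) (hmv : m ≤ v n) :
    meanStep v n b m ≤ v (n + 1) := by
  have h0 := leafProb_nonneg hv hb n
  have h1 := leafProb_le_one hv hb n
  unfold meanStep
  split_ifs with h
  · rw [h]
    push_cast
    nlinarith
  · rw [(hv.step n).resolve_right h]
    have : (1 - leafProb b (v n) n) ^ 2 ≤ 1 := pow_le_one₀ (by linarith) (by linarith)
    nlinarith

/-- A common lower bound for both kinds of step. The exact difference keeps the old gap with factor
1-q' or (1-q')^2, and adds m(q'-q) times 1 or 2-q-q'; both of the latter are at least 1-q. -/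
theorem le_meanStep_sub {b b' m m' : ℝ} (hb : -1 < b) (hb' : -1 < b') (hbb : b ≤ b')
    (hm : 0 ≤ m) (hmm : m' ≤ m) :
    (1 - leafProb b' (v n) n) ^ 2 * (m - m') + m * (leafProb b' (v n) n - leafProb b (v n) n)
      * (1 - leafProb b (v n) n) ≤ meanStep v n b m - meanStep v n b' m' := by
  have h0 := leafProb_nonneg hv hb n
  have h1 := leafProb_le_one hv hb' n
  have h2 := leafProb_mono hv hb hb' n hbb
  unfold meanStep
  set q := leafProb b (v n) n
  set q' := leafProb b' (v n) n
  have h3 : 0 ≤ m * (q' - q) := mul_nonneg hm (by linarith)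
  split_ifs
  · have h4 : 0 ≤ (1 - q') * q' * (m - m') :=
      mul_nonneg (mul_nonneg (by linarith) (by linarith)) (by linarith)
    nlinarith [mul_nonneg h3 h0]
  · nlinarith [mul_nonneg h3 (sub_nonneg.2 h1)]

/-- The old error is not amplified, since the slope is at most one; the new error is the leaf count,
at most `v n`, times the change of the leaf probability, up to a factor 2. -/
theorem abs_meanStep_sub_le {b b' m m' : ℝ} (hb : -1 < b) (hb' : -1 < b') (hm : 0 ≤ m)
    (hmv : m ≤ v n) : |meanStep v n b m - meanStep v n b' m'| ≤ |m - m'| + 4 * |b - b'| := by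
  have h1 : |meanStep v n b m - meanStep v n b' m| ≤ 4 * |b - b'| := by
    have h0 := leafProb_nonneg hv hb n
    have h0' := leafProb_nonneg hv hb' n
    have h1 := leafProb_le_one hv hb n
    have h1' := leafProb_le_one hv hb' n
    have h2 := mul_abs_leafProb_sub_le hv hb hb' n
    rw [abs_sub_comm b' b] at h2
    unfold meanStep
    set q := leafProb b (v n) n
    set q' := leafProb b' (v n) n
    have h3 : m * |q' - q| ≤ 2 * |b - b'| :=
      (mul_le_mul_of_nonneg_right hmv (abs_nonneg _)).trans h2
    split_ifs
    · rw [show 1 + (1 - q) * m - (1 + (1 - q') * m) = m * (q' - q) by ring, abs_mul,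
        abs_of_nonneg hm]
      linarith [abs_nonneg (b - b')]
    · rw [show (1 - q) ^ 2 * m - (1 - q') ^ 2 * m = m * (q' - q) * (2 - q - q') by ring, abs_mul,
        abs_mul, abs_of_nonneg hm]
      have h4 : |2 - q - q'| ≤ 2 := by rw [abs_le]; constructor <;> linarith
      have h5 : 0 ≤ m * |q' - q| := by positivity
      nlinarith
  have h2 : |meanStep v n b' m - meanStep v n b' m'| ≤ |m - m'| := by
    obtain ⟨c, r, hr0, hr1, hcr⟩ := exists_meanStep_eq hv hb' n
    rw [hcr, hcr, show c + r * m - (c + r * m') = r * (m - m') by ring, abs_mul, abs_of_nonneg hr0]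
    exact mul_le_of_le_one_left (abs_nonneg _) hr1
  have h3 := abs_sub_le (meanStep v n b m) (meanStep v n b' m) (meanStep v n b' m')
  linarith

end MeanStep

/-! ### The mean recursion under two parameter sequences. -/

section CondMean

variable {v : ℕ → ℕ} (hv : IsCounts v) {b b' : ℕ → ℝ} (hb : ∀ t, -1 < b t) (hb' : ∀ t, -1 < b' t)
include hv hb

theorem condMean_mem {S n : ℕ} (hSn : S ≤ n) {y : ℝ} (hy : 0 ≤ y) (hyv : y ≤ v S) :
    0 ≤ condMean v b S y n ∧ condMean v b S y n ≤ v n := by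
  induction n, hSn using Nat.le_induction with
  | base => rw [condMean_of_le _ _ _ le_rfl]; exact ⟨hy, hyv⟩
  | succ n hn ih =>
    rw [condMean_succ _ _ _ hn]
    exact ⟨meanStep_nonneg hv n (hb _) ih.1, meanStep_le hv n (hb _) ih.1 ih.2⟩

theorem mean_mem (n : ℕ) : 0 ≤ mean v b n ∧ mean v b n ≤ v n :=
  condMean_mem hv hb n.zero_le zero_le_one (hv.one_le_cast 0)

include hb'

theorem abs_condMean_sub_le {S n : ℕ} (hSn : S ≤ n) {y y' : ℝ} (hy : 0 ≤ y) (hyv : y ≤ v S) :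
    |condMean v b S y n - condMean v b' S y' n|
      ≤ |y - y'| + 4 * ∑ j ∈ Finset.Ico S n, |b (j + 1) - b' (j + 1)| := by
  induction n, hSn using Nat.le_induction with
  | base => simp [condMean_of_le _ _ _ le_rfl]
  | succ n hn ih =>
    obtain ⟨h1, h2⟩ := condMean_mem hv hb hn hy hyv
    rw [condMean_succ _ _ _ hn, condMean_succ _ _ _ hn, Finset.sum_Ico_succ_top hn]
    linarith [abs_meanStep_sub_le hv n (m' := condMean v b' S y' n) (hb (n + 1)) (hb' (n + 1)) h1 h2]

theorem condMean_anti {S n : ℕ} (hSn : S ≤ n) (hbb : ∀ j, S ≤ j → j < n → b (j + 1) ≤ b' (j + 1))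
    {y : ℝ} (hy : 0 ≤ y) (hyv : y ≤ v S) : condMean v b' S y n ≤ condMean v b S y n := by
  induction n, hSn using Nat.le_induction with
  | base => simp [condMean_of_le _ _ _ le_rfl]
  | succ n hn ih =>
    have ih := ih fun j hj hjn => hbb j hj (by omega)
    have hbn := hbb n hn (by omega)
    have h1 := (condMean_mem hv hb hn hy hyv).1
    rw [condMean_succ _ _ _ hn, condMean_succ _ _ _ hn, ← sub_nonneg]
    refine le_trans ?_ (le_meanStep_sub hv n (hb _) (hb' _) hbn h1 ih)
    have h2 := leafProb_mono hv (hb _) (hb' _) n hbn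
    have h3 := leafProb_le_one hv (hb (n + 1)) n
    exact add_nonneg (mul_nonneg (sq_nonneg _) (by linarith))
      (mul_nonneg (mul_nonneg h1 (by linarith)) (by linarith))

/-- The last step alone creates a strict gap, provided that leaves are present before it. -/
theorem condMean_strictAnti {S n : ℕ} (hSn : S ≤ n) (hn : 0 < n)
    (hbb : ∀ j, S ≤ j → j < n + 1 → b (j + 1) ≤ b' (j + 1)) (hlt : b (n + 1) < b' (n + 1))
    {y : ℝ} (hy : 0 ≤ y) (hyv : y ≤ v S) (hpos : 0 < condMean v b S y n) :
    condMean v b' S y (n + 1) < condMean v b S y (n + 1) := by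
  have h := condMean_anti hv hb hb' hSn (fun j hj hjn => hbb j hj (by omega)) hy hyv
  rw [condMean_succ _ _ _ hSn, condMean_succ _ _ _ hSn, ← sub_pos]
  refine lt_of_lt_of_le ?_ (le_meanStep_sub hv n (hb _) (hb' _) hlt.le hpos.le h)
  have h2 := leafProb_strictMono hv (hb _) (hb' _) n hlt hn
  have h3 := leafProb_le_one hv (hb' (n + 1)) n
  exact add_pos_of_nonneg_of_pos (mul_nonneg (sq_nonneg _) (by linarith))
    (mul_pos (mul_pos hpos (by linarith)) (by linarith))

omit hv hb hb'

theorem condMean_congr {S n : ℕ} (hbb : ∀ j, S ≤ j → j < n → b (j + 1) = b' (j + 1)) (y : ℝ) :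
    condMean v b S y n = condMean v b' S y n := by
  induction n with
  | zero => rfl
  | succ n ih =>
    rcases Nat.lt_or_ge n S with h | h
    · rw [condMean_of_le _ _ _ h, condMean_of_le _ _ _ h]
    · rw [condMean_succ _ _ _ h, condMean_succ _ _ _ h, ih fun j hj hjn => hbb j hj (by omega),
        hbb n h (by omega)]

theorem condMean_mean (v : ℕ → ℕ) (b : ℕ → ℝ) {S n : ℕ} (hSn : S ≤ n) :
    condMean v b S (mean v b S) n = mean v b n := by
  induction n, hSn using Nat.le_induction with
  | base => rw [condMean_of_le _ _ _ le_rfl]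
  | succ n hn ih => rw [condMean_succ _ _ _ hn, mean_succ, ih]

end CondMean

/-! ### Linear lower bounds for the mean and for its response to the parameters. -/

/-- Unrolling the recurrence gives a sum of discounted increments; each discount is at least
θ^(m-k). -/
theorem pow_mul_le_of_recurrence {D c : ℕ → ℝ} {θ e : ℝ} (hθ : 0 ≤ θ) (hθ1 : θ ≤ 1) (he : 0 ≤ e)
    (hc : Monotone c) {k m : ℕ} (hkm : k ≤ m) (hk : 0 ≤ D k)
    (hD : ∀ n, k ≤ n → n < m → θ * D n + e * (c (n + 1) - c n) ≤ D (n + 1)) :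
    θ ^ (m - k) * (e * (c m - c k)) ≤ D m := by
  induction m, hkm using Nat.le_induction with
  | base => simpa using hk
  | succ n hn ih =>
    have ih := ih fun j hj hjn => hD j hj (by omega)
    have h1 := hD n hn (by omega)
    have h2 : θ ^ (n + 1 - k) ≤ 1 := pow_le_one₀ hθ hθ1
    have h3 : 0 ≤ e * (c (n + 1) - c n) := mul_nonneg he (sub_nonneg.2 (hc n.le_succ))
    have h4 : θ ^ (n + 1 - k) = θ * θ ^ (n - k) := by
      rw [Nat.sub_add_comm hn, pow_succ, mul_comm]
    have h5 := mul_le_mul_of_nonneg_left ih hθ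
    have h6 := mul_le_mul_of_nonneg_right h2 h3
    rw [one_mul] at h6
    calc θ ^ (n + 1 - k) * (e * (c (n + 1) - c k))
        = θ ^ (n + 1 - k) * (e * (c n - c k)) + θ ^ (n + 1 - k) * (e * (c (n + 1) - c n)) := by ring
      _ ≤ θ * D n + e * (c (n + 1) - c n) := by
        rw [h4] at h6 ⊢
        linarith
      _ ≤ _ := h1

/-- Up to T steps with loss factor (1-C/T)^2 keep a constant fraction, by 1-y ≥ exp(-2y) for 0 ≤ y ≤
1/2. -/
theorem exp_le_pow {C : ℝ} {T j : ℕ} (hC : 0 < C) (hT : 2 * C ≤ T) (hj : j ≤ T) :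
    Real.exp (-(4 * C)) ≤ ((1 - C / T) ^ 2) ^ j := by
  have hT0 : (0 : ℝ) < T := by linarith
  set y := C / T with hy
  have hy0 : 0 < y := by positivity
  have hy1 : y ≤ 1 / 2 := by rw [hy, div_le_iff₀ hT0]; linarith
  have h1 : Real.exp (-(2 * y)) ≤ 1 - y := by
    rw [Real.exp_neg, inv_le_comm₀ (Real.exp_pos _) (by linarith)]
    refine le_trans ?_ (Real.add_one_le_exp (2 * y))
    rw [inv_le_iff_one_le_mul₀ (by linarith)]
    nlinarith
  rw [← pow_mul]
  calc Real.exp (-(4 * C)) = Real.exp (-(2 * y)) ^ (2 * T) := by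
        rw [← Real.exp_nat_mul]
        congr 1
        rw [hy]; push_cast; field_simp; ring
    _ ≤ (1 - y) ^ (2 * T) := pow_le_pow_left₀ (Real.exp_pos _).le h1 _
    _ ≤ (1 - y) ^ (2 * j) := pow_le_pow_of_le_one (by linarith) (by linarith) (by omega)

theorem leafProb_le_div {v : ℕ → ℕ} (hv : IsCounts v) {p : ℝ} (hp : 0 < p)
    (hpv : ∀ n : ℕ, 0 < n → p * n ≤ v n) {b : ℝ} (hb : -1 < b) {r T : ℝ} (hr : 0 < r) (hT : 0 < T)
    {n : ℕ} (hn : r * T ≤ n) : leafProb b (v n) n ≤ 1 / (p * r) / T := by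
  have h1 : 0 < r * T := by positivity
  have h2 : 0 < n := by
    have : (0 : ℝ) < n := by linarith
    exact_mod_cast this
  refine (leafProb_le_inv hv hb n).trans ?_
  rw [div_div]
  refine one_div_le_one_div_of_le (by positivity) ?_
  refine le_trans ?_ (hpv n h2)
  rw [mul_assoc]
  gcongr

/-- The mean number of leaves grows at least linearly, uniformly in the attachment parameters. -/
theorem exists_mul_le_mean {p η : ℝ} (hp : 0 < p) (hη : 0 < η) : ∃ c : ℝ, 0 < c ∧ ∃ N : ℝ,
    ∀ v : ℕ → ℕ, IsCounts v → (∀ n : ℕ, 0 < n → p * n ≤ v n) → ∀ b : ℕ → ℝ, (∀ t, -1 < b t) →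
    ∀ T : ℕ, N ≤ T → ∀ n ≤ T, η * T ≤ n → c * T ≤ mean v b n := by
  -- The recursion is started at a time k between rT and 2rT. From there leaf probabilities are at
  -- most C/T, while v n ≥ 8rT and v k ≤ 2rT+1, so at least 4rT vertices are still to come.
  set r := p * η / 8 with hr
  have hr0 : 0 < r := by positivity
  set C := 1 / (p * r) with hC
  have hC0 : 0 < C := by positivity
  refine ⟨Real.exp (-(4 * C)) * (4 * r), by positivity, max (2 * C) (1 / r),
    fun v hv hpv b hb T hT n hnT hn => ?_⟩
  have hTC := (le_max_left _ _).trans hT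
  have hTr := (le_max_right _ _).trans hT
  have hT0 : (0 : ℝ) < T := by linarith
  rw [div_le_iff₀ hr0] at hTr
  have hp2 : p ≤ 2 := by
    have h1 := hpv 1 one_pos
    have h2 := hv.cast_le_succ 1
    push_cast at h1 h2
    linarith
  set k := ⌊2 * r * T⌋₊
  have hk1 : r * T ≤ k := by
    have := Nat.lt_floor_add_one (2 * r * T)
    linarith
  have hk2 : (k : ℝ) ≤ 2 * r * T := Nat.floor_le (by positivity)
  have hηT : 8 * r * T ≤ p * n := by
    have := mul_le_mul_of_nonneg_left hn hp.le
    rw [hr]; linarith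
  have hn0 : 0 < n := by
    have : (0 : ℝ) < n := lt_of_lt_of_le (by positivity) hn
    exact_mod_cast this
  have hkn : k ≤ n := by
    have : (k : ℝ) ≤ n := by nlinarith
    exact_mod_cast this
  have hy1 : C / T ≤ 1 / 2 := by rw [div_le_iff₀ hT0]; linarith
  have hy0 : 0 < C / T := by positivity
  -- Vertex-steps add one leaf and edge-steps none, so the source term is the increment of v.
  have key := pow_mul_le_of_recurrence (D := mean v b) (c := fun n => (v n : ℝ))
    (θ := (1 - C / T) ^ 2) (e := 1) (sq_nonneg _) (pow_le_one₀ (by linarith) (by linarith))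
    zero_le_one (monotone_nat_of_le_succ fun n => by
      exact_mod_cast (by rcases hv.step n with h | h <;> omega : v n ≤ v (n + 1))) hkn (mean_mem hv hb k).1 (fun j hj hjn => by
      have hq := leafProb_le_div hv hp hpv (hb (j + 1)) hr0 hT0
        (hk1.trans (by exact_mod_cast hj))
      have hq0 := leafProb_nonneg hv (hb (j + 1)) j
      have hm := (mean_mem hv hb j).1
      rw [mean_succ, meanStep]
      have hsq : (1 - C / T) ^ 2 ≤ (1 - leafProb (b (j + 1)) (v j) j) ^ 2 :=
        pow_le_pow_left₀ (by linarith) (by linarith) 2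
      split_ifs with h
      · have hsq' : (1 - leafProb (b (j + 1)) (v j) j) ^ 2 ≤ 1 - leafProb (b (j + 1)) (v j) j := by
          nlinarith
        have := mul_le_mul_of_nonneg_right (hsq.trans hsq') hm
        rw [h]; push_cast; linarith
      · have := mul_le_mul_of_nonneg_right hsq hm
        rw [(hv.step j).resolve_right h]
        linarith)
  refine le_trans ?_ key
  rw [mul_assoc]
  have h1 := exp_le_pow hC0 hTC (j := n - k) (by omega)
  have h2 := hpv n hn0
  have h3 := hv.cast_le_succ k
  have h4 : 4 * r * T ≤ 1 * ((v n : ℝ) - v k) := by linarith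
  exact mul_le_mul h1 h4 (by positivity) (by positivity)

/-- Increasing the attachment parameters by a fixed amount during a positive fraction of the time
decreases the mean number of leaves by a linear amount. -/
theorem exists_mean_gap {p η δ B : ℝ} (hp : 0 < p) (hη : 0 < η) (hδ : 0 < δ) (hB : 0 ≤ B) :
    ∃ c : ℝ, 0 < c ∧ ∃ N : ℝ, ∀ v : ℕ → ℕ, IsCounts v → (∀ n : ℕ, 0 < n → p * n ≤ v n) →
    ∀ b b' : ℕ → ℝ, (∀ t, -1 < b t) → (∀ t, -1 < b' t) → ∀ T : ℕ, N ≤ T →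
    (∀ n < T, b (n + 1) ≤ b' (n + 1)) → (∀ n < T, b' (n + 1) ≤ B) →
    ∀ k m : ℕ, m ≤ T → (k : ℝ) + η * T ≤ m →
    (∀ n, k ≤ n → n < m → b (n + 1) + δ ≤ b' (n + 1)) →
    mean v b' T + c * T ≤ mean v b T := by
  obtain ⟨c₁, hc₁, N₁, hN₁⟩ := exists_mul_le_mean hp (half_pos hη)
  set C := 1 / (p * (η / 2)) with hC
  have hC0 : 0 < C := by positivity
  -- The gap created in one step: at least c₁T leaves, times a rise of the leaf probability of at
  -- least δ/((5+2B)^2 T), times 1-q ≥ 1/2.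
  set e := c₁ * (δ / (5 + 2 * B) ^ 2) * (1 / 2) with he
  have he0 : 0 < e := by positivity
  refine ⟨Real.exp (-(4 * C)) * (e * (η / 4)), by positivity, max N₁ (max (2 * C) (4 / η)),
    fun v hv hpv b b' hb hb' T hT hbb hbB k m hmT hkm hgap => ?_⟩
  have hTN := (le_max_left _ _).trans hT
  have hTC := (le_max_left _ _).trans ((le_max_right _ _).trans hT)
  have hTη := (le_max_right _ _).trans ((le_max_right _ _).trans hT)
  rw [div_le_iff₀ hη] at hTη
  have hT0 : (0 : ℝ) < T := by linarith
  have hy1 : C / T ≤ 1 / 2 := by rw [div_le_iff₀ hT0]; linarith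
  have hy0 : 0 < C / T := by positivity
  -- From k' on, the leaf probabilities are O(1/T) and the mean is of order T; at least ηT/4 steps
  -- remain before `m`.
  set k' := max k ⌈η / 2 * T⌉₊
  have hk'm : (k' : ℝ) + η / 4 * T ≤ m := by
    have h1 : (⌈η / 2 * T⌉₊ : ℝ) < η / 2 * T + 1 := Nat.ceil_lt_add_one (by positivity)
    have h2 : (0 : ℝ) ≤ k := k.cast_nonneg
    rcases max_cases k ⌈η / 2 * T⌉₊ with ⟨h, -⟩ | ⟨h, -⟩ <;> simp only [k', h]
    · nlinarith
    · nlinarith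
  have hk'm' : k' ≤ m := by
    have : (k' : ℝ) ≤ m := by nlinarith
    exact_mod_cast this
  have hanti : ∀ n ≤ T, mean v b' n ≤ mean v b n := fun n hn =>
    condMean_anti hv hb hb' n.zero_le (fun j _ hj => hbb j (by omega)) zero_le_one
      (hv.one_le_cast 0)
  -- The counter `min n m` switches the source off at `m`; afterwards the gap is only discounted.
  have key := pow_mul_le_of_recurrence (D := fun n => mean v b n - mean v b' n)
    (c := fun n => ((min n m : ℕ) : ℝ)) (θ := (1 - C / T) ^ 2) (e := e) (sq_nonneg _)
    (pow_le_one₀ (by linarith) (by linarith)) he0.le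
    (fun i j hij => Nat.cast_le.2 (min_le_min_right m hij)) (hk'm'.trans hmT)
    (sub_nonneg.2 (hanti _ (hk'm'.trans hmT))) (fun n hn hnT => by
      have hnη : η / 2 * T ≤ n :=
        (Nat.le_ceil _).trans (by exact_mod_cast (le_max_right _ _).trans hn)
      have hn0' : (0 : ℝ) < n := lt_of_lt_of_le (by positivity) hnη
      have hn0 : 0 < n := by exact_mod_cast hn0'
      have hnT' : (n : ℝ) ≤ T := by exact_mod_cast hnT.le
      have hq := leafProb_le_div hv hp hpv (hb (n + 1)) (half_pos hη) hT0 hnη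
      have hq' := leafProb_le_div hv hp hpv (hb' (n + 1)) (half_pos hη) hT0 hnη
      have hm := hN₁ v hv hpv b hb T hTN n hnT.le hnη
      have hm0 := (mean_mem hv hb n).1
      have hdiff := le_leafProb_sub hv (hb (n + 1)) (hb' (n + 1)) n (hbb n hnT) hn0 (hbB n hnT)
      have hD := sub_nonneg.2 (hanti n hnT.le)
      have hmono := sub_nonneg.2 (leafProb_mono hv (hb (n + 1)) (hb' (n + 1)) n (hbb n hnT))
      simp only [mean_succ]
      refine le_trans ?_ (le_meanStep_sub hv n (hb _) (hb' _) (hbb n hnT) hm0 (hanti n hnT.le))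
      refine add_le_add (mul_le_mul_of_nonneg_right
        (pow_le_pow_left₀ (by linarith) (by linarith) 2) hD) ?_
      by_cases hnm : n < m
      · rw [min_eq_left hnm, min_eq_left hnm.le]
        push_cast
        rw [add_sub_cancel_left, mul_one, he]
        refine mul_le_mul ?_ (by linarith) (by norm_num) (mul_nonneg hm0 hmono)
        calc c₁ * (δ / (5 + 2 * B) ^ 2) = (c₁ * T) * (δ / ((5 + 2 * B) ^ 2 * T)) := by field_simp
          _ ≤ mean v b n * ((b' (n + 1) - b (n + 1)) / ((5 + 2 * B) ^ 2 * n)) := by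
            have := hgap n ((le_max_left _ _).trans hn) hnm
            gcongr
            all_goals linarith
          _ ≤ _ := mul_le_mul_of_nonneg_left hdiff hm0
      · rw [min_eq_right (by omega), min_eq_right (by omega), sub_self, mul_zero]
        exact mul_nonneg (mul_nonneg hm0 hmono) (by linarith))
  rw [min_eq_right hmT, min_eq_left hk'm'] at key
  have h1 := exp_le_pow hC0 hTC (j := T - k') (by omega)
  have h2 : Real.exp (-(4 * C)) * (e * (η / 4)) * T
      ≤ ((1 - C / T) ^ 2) ^ (T - k') * (e * (m - k')) := by
    rw [mul_assoc, mul_assoc]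
    exact mul_le_mul h1 (mul_le_mul_of_nonneg_left (by linarith) he0.le) (by positivity)
      (by positivity)
  linarith

/-! ### The function `f` and its minimizer on a fixed trajectory. -/

/-- The parameters `a`, replaced by the constant `α` after time `S`. -/
def splice (a : ℕ → ℝ) (S : ℕ) (α : ℝ) : ℕ → ℝ := fun t => if S < t then α else a t

theorem splice_of_lt (a : ℕ → ℝ) {S t : ℕ} (α : ℝ) (h : S < t) : splice a S α t = α := if_pos h

theorem splice_of_le (a : ℕ → ℝ) {S t : ℕ} (α : ℝ) (h : t ≤ S) : splice a S α t = a t :=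
  if_neg h.not_gt

theorem neg_one_lt_splice {a : ℕ → ℝ} (ha : ∀ t, -1 < a t) (S : ℕ) {α : ℝ} (hα : -1 < α) (t : ℕ) :
    -1 < splice a S α t := by
  unfold splice
  split_ifs
  exacts [hα, ha t]

theorem mean_splice (v : ℕ → ℕ) (a : ℕ → ℝ) (α : ℝ) {S n : ℕ} (hSn : S ≤ n) :
    mean v (splice a S α) n = condMean v (fun _ => α) S (mean v a S) n := by
  have h : mean v (splice a S α) S = mean v a S :=
    condMean_congr (fun j _ hj => splice_of_le a α hj) 1
  rw [← condMean_mean v _ hSn, h]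
  exact condMean_congr (fun j hj _ => splice_of_lt a α (by omega)) _

section Estimate

variable {v : ℕ → ℕ} (hv : IsCounts v) {a : ℕ → ℝ} (ha : ∀ t, -1 < a t) {S T : ℕ}
include hv ha

theorem abs_mean_sub_le {b : ℕ → ℝ} (hb : ∀ t, -1 < b t) {k m : ℕ} (hkm : k ≤ m) {M : ℝ}
    (h : ∀ j < T, a (j + 1) = b (j + 1) ∨ k ≤ j ∧ j < m ∧ |a (j + 1) - b (j + 1)| ≤ M)
    (hM : 0 ≤ M) : |mean v a T - mean v b T| ≤ 4 * (M * (m - k)) := by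
  refine (abs_condMean_sub_le hv ha hb T.zero_le zero_le_one (hv.one_le_cast 0)).trans ?_
  rw [sub_self, abs_zero, zero_add]
  gcongr
  calc ∑ j ∈ Finset.Ico 0 T, |a (j + 1) - b (j + 1)|
      ≤ ∑ j ∈ Finset.Ico 0 T, if j ∈ Finset.Ico k m then M else 0 := by
        refine Finset.sum_le_sum fun j hj => ?_
        rcases h j (Finset.mem_Ico.1 hj).2 with h | ⟨h1, h2, h3⟩
        · rw [h, sub_self, abs_zero]
          split_ifs <;> simp [hM]
        · rwa [if_pos (Finset.mem_Ico.2 ⟨h1, h2⟩)]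
    _ = ∑ j ∈ (Finset.Ico 0 T).filter (· ∈ Finset.Ico k m), M := by rw [Finset.sum_filter]
    _ ≤ ∑ j ∈ Finset.Ico k m, M :=
        Finset.sum_le_sum_of_subset_of_nonneg
          (fun j hj => (Finset.mem_filter.1 hj).2) fun _ _ _ => hM
    _ = M * (m - k) := by
        rw [Finset.sum_const, nsmul_eq_mul, Nat.card_Ico, Nat.cast_sub hkm, mul_comm]

variable (hST : S ≤ T) {ω : Path} (hω : ω ∈ (pathLaw a v T).support)
include hST hω

/-- `constOn` also alters the parameter at time `S`, but this value only enters the step into time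
`S`, before the conditioning; the steps after it use the times from `S + 1` on. -/
theorem f_eq_condMean {α : ℝ} (hα : -1 < α) :
    f a v S T α ω = condMean v (fun _ => α) S (x S ω) T := by
  have h1 : ∀ t, -1 < constOn a S T α t := fun t => by
    unfold constOn
    split_ifs
    exacts [hα, ha t]
  rw [f, condExp_leaves_eq h1 hv hST (by rwa [support_pathLaw_eq h1 hv ha])]
  exact condMean_congr (fun j hj hjT => if_pos ⟨by omega, by omega⟩) _

theorem abs_condMean_sub_mean_splice_le {n : ℕ} (hSn : S ≤ n) {α : ℝ} (hα : -1 < α) :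
    |condMean v (fun _ => α) S (x S ω) n - mean v (splice a S α) n|
      ≤ |(x S ω : ℝ) - mean v a S| := by
  rw [mean_splice v a α hSn]
  refine (abs_condMean_sub_le hv (fun _ => hα) (fun _ => hα) hSn (Nat.cast_nonneg _)
    (Nat.cast_le.2 (x_le ha hv hST hω))).trans ?_
  simp

theorem f_anti {α β : ℝ} (hα : -1 < α) (hαβ : α ≤ β) : f a v S T β ω ≤ f a v S T α ω := by
  have hβ : -1 < β := by linarith
  rw [f_eq_condMean hv ha hST hω hα, f_eq_condMean hv ha hST hω hβ]
  exact condMean_anti hv (fun _ => hα) (fun _ => hβ) hST (fun _ _ _ => hαβ) (Nat.cast_nonneg _)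
    (Nat.cast_le.2 (x_le ha hv hST hω))

theorem abs_f_sub_le {α β : ℝ} (hα : -1 < α) (hβ : -1 < β) :
    |f a v S T α ω - f a v S T β ω| ≤ 4 * T * |α - β| := by
  rw [f_eq_condMean hv ha hST hω hα, f_eq_condMean hv ha hST hω hβ]
  refine (abs_condMean_sub_le hv (fun _ => hα) (fun _ => hβ) hST (Nat.cast_nonneg _)
    (Nat.cast_le.2 (x_le ha hv hST hω))).trans ?_
  rw [sub_self, abs_zero, zero_add, Finset.sum_const, nsmul_eq_mul, Nat.card_Ico, ← mul_assoc]
  gcongr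
  exact Nat.sub_le _ _

/-- The intermediate value theorem yields a zero of the objective, so every minimizer is a zero;
strict monotonicity of `f` in the parameter leaves only one. -/
theorem argmin_eq_singleton (hT : 2 ≤ T) (hST' : S < T)
    (hpos : ∀ α, -1 < α → 0 < condMean v (fun _ => α) S (x S ω) (T - 1)) {lo hi : ℝ}
    (hlo : -1 < lo) (hlohi : lo ≤ hi) (hflo : (x T ω : ℝ) ≤ f a v S T lo ω)
    (hfhi : f a v S T hi ω ≤ x T ω) :
    ∃ r, -1 < r ∧ f a v S T r ω = x T ω ∧ argmin a v S T ω = {r} := by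
  have hcont : ContinuousOn (fun α => f a v S T α ω) (Set.Icc lo hi) := by
    refine (LipschitzOnWith.of_dist_le_mul (K := 4 * T) fun α hα β hβ => ?_).continuousOn
    rw [Real.dist_eq, Real.dist_eq]
    exact abs_f_sub_le hv ha hST hω (hlo.trans_le hα.1) (hlo.trans_le hβ.1)
  obtain ⟨r, hr, hfr⟩ := intermediate_value_Icc' hlohi hcont ⟨hfhi, hflo⟩
  simp only at hfr
  have hr1 : -1 < r := hlo.trans_le hr.1
  have hstrict : ∀ α β, -1 < α → α < β → f a v S T β ω < f a v S T α ω := by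
    intro α β hα hαβ
    have hβ : -1 < β := by linarith
    -- The last step starts at time `T - 1`, which `2 ≤ T` makes positive.
    have h1 := condMean_strictAnti hv (b := fun _ => α) (b' := fun _ => β) (fun _ => hα)
      (fun _ => hβ) (n := T - 1) (by omega) (by omega) (fun _ _ _ => hαβ.le) hαβ
      (Nat.cast_nonneg (x S ω)) (Nat.cast_le.2 (x_le ha hv hST hω)) (hpos α hα)
    rw [Nat.sub_add_cancel (by omega)] at h1
    rwa [f_eq_condMean hv ha hST hω hα, f_eq_condMean hv ha hST hω hβ]
  refine ⟨r, hr1, hfr, Set.eq_singleton_iff_unique_mem.2 ⟨⟨hr1, fun β _ => ?_⟩, ?_⟩⟩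
  · change (f a v S T r ω - x T ω) ^ 2 ≤ (f a v S T β ω - x T ω) ^ 2
    rw [hfr, sub_self, zero_pow two_ne_zero]
    exact sq_nonneg _
  · rintro α ⟨hα, hmin⟩
    have h1 : (f a v S T α ω - x T ω) ^ 2 ≤ (f a v S T r ω - x T ω) ^ 2 := hmin (Set.mem_Ioi.2 hr1)
    rw [hfr, sub_self] at h1
    have h2 : f a v S T α ω = x T ω := by nlinarith
    rcases lt_trichotomy α r with h | h | h
    · linarith [hstrict _ _ hα h]
    · exact h
    · linarith [hstrict _ _ hr1 h]

end Estimate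

theorem exists_abs_mean_gap {p η α β B : ℝ} (hp : 0 < p) (hη : 0 < η) (hαβ : α ≠ β) (hB : 0 ≤ B) :
    ∃ c : ℝ, 0 < c ∧ ∃ N : ℝ, ∀ v : ℕ → ℕ, IsCounts v → (∀ n : ℕ, 0 < n → p * n ≤ v n) →
    ∀ b b' : ℕ → ℝ, (∀ t, -1 < b t) → (∀ t, -1 < b' t) → ∀ T : ℕ, N ≤ T →
    (∀ n < T, b (n + 1) = b' (n + 1) ∨ b (n + 1) = α ∧ b' (n + 1) = β) →
    (∀ n < T, b (n + 1) ≤ B) → (∀ n < T, b' (n + 1) ≤ B) →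
    ∀ k m : ℕ, m ≤ T → (k : ℝ) + η * T ≤ m →
    (∀ n, k ≤ n → n < m → b (n + 1) = α ∧ b' (n + 1) = β) →
    c * T ≤ |mean v b' T - mean v b T| := by
  rcases lt_or_gt_of_ne hαβ with h | h
  · obtain ⟨c, hc, N, hN⟩ := exists_mean_gap hp hη (sub_pos.2 h) hB
    refine ⟨c, hc, N, fun v hv hpv b b' hb hb' T hT heq hbB hbB' k m hm hkm hgap => ?_⟩
    have := hN v hv hpv b b' hb hb' T hT (fun n hn => by
      rcases heq n hn with h1 | ⟨h1, h2⟩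
      · exact h1.le
      · rw [h1, h2]; exact h.le) hbB' k m hm hkm (fun n hn hnm => by
      rw [(hgap n hn hnm).1, (hgap n hn hnm).2]; linarith)
    rw [abs_sub_comm]
    exact le_trans (by linarith) (le_abs_self _)
  · obtain ⟨c, hc, N, hN⟩ := exists_mean_gap hp hη (sub_pos.2 h) hB
    refine ⟨c, hc, N, fun v hv hpv b b' hb hb' T hT heq hbB hbB' k m hm hkm hgap => ?_⟩
    have := hN v hv hpv b' b hb' hb T hT (fun n hn => by
      rcases heq n hn with h1 | ⟨h1, h2⟩
      · exact h1.ge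
      · rw [h1, h2]; exact h.le) hbB k m hm hkm (fun n hn hnm => by
      rw [(hgap n hn hnm).1, (hgap n hn hnm).2]; linarith)
    exact le_trans (by linarith) (le_abs_self _)

/-- The numbers of leaves at the times `S` and `T` deviate by at most `ε T` from their means. -/
def CloseToMean (a : ℕ → ℝ) (v : ℕ → ℕ) (S T : ℕ) (ε : ℝ) (ω : Path) : Prop :=
  ω ∈ (pathLaw a v T).support ∧ |(x S ω : ℝ) - mean v a S| ≤ ε * T ∧
    |(x T ω : ℝ) - mean v a T| ≤ ε * T

theorem CloseToMean.mono {a : ℕ → ℝ} {v : ℕ → ℕ} {S T : ℕ} {ε ε' : ℝ} {ω : Path}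
    (h : CloseToMean a v S T ε ω) (hε : ε ≤ ε') : CloseToMean a v S T ε' ω :=
  have h1 : ε * T ≤ ε' * T := by gcongr
  ⟨h.1, h.2.1.trans h1, h.2.2.trans h1⟩

/-! ### Asymptotic behaviour of the estimator near the mean. -/

section Estimator

variable {v : ℕ → ℕ → ℕ} (hv : ∀ T, IsCounts (v T)) {a : ℕ → ℕ → ℝ} (ha : ∀ T t, -1 < a T t)
  {p : ℝ} (hp : 0 < p) (hpv : ∀ T n : ℕ, 0 < n → p * n ≤ v T n) {K : ℝ} (haK : ∀ T t, a T t ≤ K)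
  {S : ℕ → ℕ} (hST : ∀ᶠ T in atTop, S T < T) {ahat : ℕ → Path → ℝ}
  (hahat : ∀ T ω, (argmin (a T) (v T) (S T) T ω).Nonempty →
      ahat T ω ∈ argmin (a T) (v T) (S T) T ω)
  (hlin : ∃ δ : ℝ, 0 < δ ∧ ∀ᶠ T : ℕ in atTop, (S T : ℝ) + δ * T ≤ T)

-- With the mirror statement below, this supplies the test values at which `f` lies on either side
-- of x_T by a margin linear in T.
include hv ha hp hpv haK hST hlin in
theorem exists_mean_splice_gap {α lo : ℝ} (hα : -1 < α) (hlo : α < lo)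
    (halo : ∀ᶠ T in atTop, ∀ t, S T < t → t ≤ T → lo ≤ a T t) :
    ∃ c : ℝ, 0 < c ∧ ∀ᶠ T : ℕ in atTop,
      mean (v T) (a T) T + c * T ≤ mean (v T) (splice (a T) (S T) α) T := by
  obtain ⟨η, hη, hlin⟩ := hlin
  obtain ⟨c, hc, N, hN⟩ := exists_mean_gap (B := max K 0) hp hη (sub_pos.2 hlo) (le_max_right _ _)
  refine ⟨c, hc, ?_⟩
  filter_upwards [hlin, hST, halo, tendsto_natCast_atTop_atTop.eventually_ge_atTop N]
    with T hlinT hSTT haT hT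
  refine hN (v T) (hv T) (hpv T) _ _ (neg_one_lt_splice (ha T) _ hα) (ha T) T hT (fun n hn => ?_)
    (fun n _ => (haK T _).trans (le_max_left _ _)) (S T) T le_rfl hlinT fun n hn hnT => ?_
  · rcases Nat.lt_or_ge n (S T) with h | h
    · rw [splice_of_le _ _ h]
    · rw [splice_of_lt _ _ (by omega)]
      exact hlo.le.trans (haT _ (by omega) hn)
  · rw [splice_of_lt _ _ (by omega)]
    linarith [haT (n + 1) (by omega) hnT]

include hv ha hp hpv haK hST hlin in
theorem exists_mean_splice_gap' {α hi : ℝ} (hα : hi < α) (hα1 : -1 < α)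
    (hahi : ∀ᶠ T in atTop, ∀ t, S T < t → t ≤ T → a T t ≤ hi) :
    ∃ c : ℝ, 0 < c ∧ ∀ᶠ T : ℕ in atTop,
      mean (v T) (splice (a T) (S T) α) T + c * T ≤ mean (v T) (a T) T := by
  obtain ⟨η, hη, hlin⟩ := hlin
  obtain ⟨c, hc, N, hN⟩ := exists_mean_gap (B := max (max K α) 0) hp hη (sub_pos.2 hα)
    (le_max_right _ _)
  refine ⟨c, hc, ?_⟩
  filter_upwards [hlin, hST, hahi, tendsto_natCast_atTop_atTop.eventually_ge_atTop N]
    with T hlinT hSTT haT hT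
  refine hN (v T) (hv T) (hpv T) _ _ (ha T) (neg_one_lt_splice (ha T) _ hα1) T hT (fun n hn => ?_)
    (fun n _ => ?_) (S T) T le_rfl hlinT fun n hn hnT => ?_
  · rcases Nat.lt_or_ge n (S T) with h | h
    · rw [splice_of_le _ _ h]
    · rw [splice_of_lt _ _ (by omega)]
      exact (haT _ (by omega) hn).trans hα.le
  · refine le_trans ?_ (le_max_left _ _)
    unfold splice
    split_ifs
    exacts [le_max_right _ _, (haK T _).trans (le_max_left _ _)]
  · rw [splice_of_lt _ _ (by omega)]
    linarith [haT (n + 1) (by omega) hnT]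

include hv ha hST in
theorem tendsto_law_of_closeToMean {ε : ℝ} (hε : 0 < ε) {A : ℕ → Set Path}
    (hA : ∀ᶠ T in atTop, ∀ ω, CloseToMean (a T) (v T) (S T) T ε ω → ω ∈ A T) :
    Tendsto (fun T => law (a T) (v T) T (A T)) atTop (𝓝 1) :=
  tendsto_law_of_close hv ha (hST.mono fun _ h => h.le) A hε
    (hA.mono fun _ h ω h1 h2 h3 => h ω ⟨h1, h2, h3⟩)

include hv ha in
theorem CloseToMean.abs_f_sub_le {T : ℕ} (hSTT : S T ≤ T) {ε : ℝ} {ω : Path}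
    (h : CloseToMean (a T) (v T) (S T) T ε ω) {α : ℝ} (hα : -1 < α) :
    |f (a T) (v T) (S T) T α ω - mean (v T) (splice (a T) (S T) α) T| ≤ ε * T := by
  rw [f_eq_condMean (hv T) (ha T) hSTT h.1 hα]
  exact (abs_condMean_sub_mean_splice_le (hv T) (ha T) hSTT h.1 hSTT hα).trans h.2.1

include hv ha hp hpv haK hST hahat hlin

/-- Close to the mean, the estimator is the unique minimizer and fits the data exactly. -/
theorem exists_argmin_eq {lo hi : ℝ} (hlo : -1 < lo) (hlohi : lo ≤ hi)
    (halohi : ∀ᶠ T in atTop, ∀ t, S T < t → t ≤ T → lo ≤ a T t ∧ a T t ≤ hi) :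
    ∃ ε : ℝ, 0 < ε ∧ ∀ᶠ T in atTop, ∀ ω, CloseToMean (a T) (v T) (S T) T ε ω →
      argmin (a T) (v T) (S T) T ω = {ahat T ω} ∧
      f (a T) (v T) (S T) T (ahat T ω) ω = x T ω ∧ -1 < ahat T ω := by
  -- The lower test value is the midpoint of -1 and `lo`: below all true parameters, yet admissible.
  have hlo' : -1 < (lo - 1) / 2 := by linarith
  have hhi' : -1 < hi + 1 := by linarith
  obtain ⟨c₁, hc₁, hgap₁⟩ := exists_mean_splice_gap hv ha hp hpv haK hST hlin hlo'
    (by linarith : (lo - 1) / 2 < lo) (halohi.mono fun _ h t h1 h2 => (h t h1 h2).1)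
  obtain ⟨c₂, hc₂, hgap₂⟩ := exists_mean_splice_gap' hv ha hp hpv haK hST hlin
    (by linarith : hi < hi + 1) hhi' (halohi.mono fun _ h t h1 h2 => (h t h1 h2).2)
  obtain ⟨c₃, hc₃, N, hN⟩ := exists_mul_le_mean hp one_half_pos
  refine ⟨min c₁ (min c₂ c₃) / 2, by positivity, ?_⟩
  filter_upwards [hgap₁, hgap₂, hST, eventually_ge_atTop 2,
    tendsto_natCast_atTop_atTop.eventually_ge_atTop N] with T h₁ h₂ hSTT hT hTN ω hω
  have hT0 : (2 : ℝ) ≤ T := by exact_mod_cast hT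
  set ε := min c₁ (min c₂ c₃) / 2 with hε
  have hε₁ : ε * T ≤ c₁ / 2 * T := by rw [hε]; gcongr; exact min_le_left _ _
  have hε₂ : ε * T ≤ c₂ / 2 * T := by
    rw [hε]; gcongr; exact (min_le_right _ _).trans (min_le_left _ _)
  have hε₃ : ε * T ≤ c₃ / 2 * T := by
    rw [hε]; gcongr; exact (min_le_right _ _).trans (min_le_right _ _)
  have hxT := abs_le.1 hω.2.2
  obtain ⟨r, hr, hfr, hmin⟩ := argmin_eq_singleton (hv T) (ha T) hSTT.le hω.1 hT hSTT
    -- The constant `c₃` is independent of the parameters, so the count before the last step is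
    -- positive for all α simultaneously.
    (fun α hα => by
      have h3 := hN (v T) (hv T) (hpv T) _ (neg_one_lt_splice (ha T) (S T) hα) T hTN (T - 1)
        (by omega) (by rw [Nat.cast_sub (by omega)]; push_cast; linarith)
      have h4 := (abs_le.1 ((abs_condMean_sub_mean_splice_le (hv T) (ha T) hSTT.le hω.1
        (n := T - 1) (by omega) hα).trans hω.2.1)).1
      have : 0 < c₃ * T := by positivity
      linarith)
    hlo' (by linarith : (lo - 1) / 2 ≤ hi + 1)
    (by linarith [(abs_le.1 (hω.abs_f_sub_le hv ha hSTT.le hlo')).1])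
    (by linarith [(abs_le.1 (hω.abs_f_sub_le hv ha hSTT.le hhi')).2])
  have hmem := hahat T ω (by rw [hmin]; exact Set.singleton_nonempty r)
  rw [hmin, Set.mem_singleton_iff] at hmem
  rw [hmem]
  exact ⟨hmin, hfr, hr⟩

omit hp hpv haK hlin hahat

/-- The estimator stays away from a parameter for which the mean of the final number of leaves
deviates linearly from the true mean. -/
theorem exists_lt_abs_sub {α c₀ : ℝ} (hα : -1 < α) (hc₀ : 0 < c₀)
    (hgap : ∀ᶠ T : ℕ in atTop,
      c₀ * T ≤ |mean (v T) (a T) T - mean (v T) (splice (a T) (S T) α) T|) :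
    ∀ᶠ T in atTop, ∀ ω, CloseToMean (a T) (v T) (S T) T (c₀ / 8) ω →
      f (a T) (v T) (S T) T (ahat T ω) ω = x T ω → -1 < ahat T ω → c₀ / 16 < |ahat T ω - α| := by
  filter_upwards [hgap, hST, eventually_gt_atTop 0] with T hgapT hSTT hT ω hω hf hr
  have hT0 : (0 : ℝ) < T := by exact_mod_cast hT
  by_contra! hcon
  have h1 := abs_f_sub_le (hv T) (ha T) hSTT.le hω.1 hr hα
  rw [hf] at h1
  have h2 := hω.abs_f_sub_le hv ha hSTT.le hα
  have h3 := hω.2.2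
  have h4 : 4 * T * |ahat T ω - α| ≤ 4 * T * (c₀ / 16) := by gcongr
  -- The errors of x_T, of the Lipschitz bound and of f(α) add up to c₀T/2, below the assumed gap
  -- c₀T.
  have h5 : |mean (v T) (a T) T - mean (v T) (splice (a T) (S T) α) T|
      ≤ c₀ / 8 * T + 4 * T * (c₀ / 16) + c₀ / 8 * T := by
    rw [abs_le] at *
    constructor <;> linarith
  have : 0 < c₀ * T := by positivity
  linarith

include hp hpv haK hlin

/-- The estimator is close to a parameter for which the mean of the final number of leaves
deviates sublinearly from the true mean. -/
theorem exists_abs_sub_lt {α : ℝ} (hα : -1 < α)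
    (hsub : ∀ ε : ℝ, 0 < ε → ∀ᶠ T : ℕ in atTop,
      |mean (v T) (a T) T - mean (v T) (splice (a T) (S T) α) T| ≤ ε * T)
    {ρ : ℝ} (hρ : 0 < ρ) :
    ∃ ε : ℝ, 0 < ε ∧ ∀ᶠ T in atTop, ∀ ω, CloseToMean (a T) (v T) (S T) T ε ω →
      f (a T) (v T) (S T) T (ahat T ω) ω = x T ω → -1 < ahat T ω → |ahat T ω - α| < ρ := by
  have hspl : ∀ T t, -1 < splice (a T) (S T) α t := fun T => neg_one_lt_splice (ha T) _ hα
  have hsplK : ∀ T t, splice (a T) (S T) α t ≤ max K α := fun T t => by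
    unfold splice
    split_ifs
    exacts [le_max_right _ _, (haK T _).trans (le_max_left _ _)]
  -- The gap lemmas are applied to the network that already has parameter α after `S`; replacing α
  -- by β there is the same as splicing β into the true network.
  have hsplice : ∀ β T, splice (splice (a T) (S T) α) (S T) β = splice (a T) (S T) β :=
    fun β T => by
      ext t
      unfold splice
      split_ifs <;> rfl
  -- The cap keeps α - σ above -1.
  set σ := min ρ ((1 + α) / 2)
  have hσ : 0 < σ := lt_min hρ (by linarith)
  have hσρ : σ ≤ ρ := min_le_left _ _
  have hσα : σ ≤ (1 + α) / 2 := min_le_right _ _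
  have hlo : -1 < α - σ := by linarith
  have hhi : -1 < α + σ := by linarith
  obtain ⟨c₁, hc₁, hgap₁⟩ := exists_mean_splice_gap hv hspl hp hpv hsplK hST hlin hlo
    (by linarith : α - σ < α) (Eventually.of_forall fun T t h _ => (splice_of_lt _ _ h).ge)
  obtain ⟨c₂, hc₂, hgap₂⟩ := exists_mean_splice_gap' hv hspl hp hpv hsplK hST hlin
    (by linarith : α < α + σ) hhi (Eventually.of_forall fun T t h _ => (splice_of_lt _ _ h).le)
  simp only [hsplice] at hgap₁ hgap₂
  -- Three errors, those of x_T, of M(α) against the true mean, and of f(α ± σ), each take at most a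
  -- quarter of the gap.
  refine ⟨min c₁ c₂ / 4, by positivity, ?_⟩
  filter_upwards [hgap₁, hgap₂, hsub (min c₁ c₂ / 4) (by positivity), hST, eventually_gt_atTop 0]
    with T h₁ h₂ hsubT hSTT hT ω hω hf hr
  have hT0 : (0 : ℝ) < T := by exact_mod_cast hT
  have hε₁ : min c₁ c₂ / 4 * T ≤ c₁ / 4 * T := by gcongr; exact min_le_left _ _
  have hε₂ : min c₁ c₂ / 4 * T ≤ c₂ / 4 * T := by gcongr; exact min_le_right _ _
  have hc₁T : 0 < c₁ * T := by positivity
  have hc₂T : 0 < c₂ * T := by positivity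
  have hxT := abs_le.1 hω.2.2
  have hsubT := abs_le.1 hsubT
  rw [abs_lt]
  constructor
  · by_contra! hcon
    have h1 := f_anti (hv T) (ha T) hSTT.le hω.1 hr (by linarith : ahat T ω ≤ α - σ)
    linarith [(abs_le.1 (hω.abs_f_sub_le hv ha hSTT.le hlo)).1]
  · by_contra! hcon
    have h1 := f_anti (hv T) (ha T) hSTT.le hω.1 hhi (by linarith : α + σ ≤ ahat T ω)
    linarith [(abs_le.1 (hω.abs_f_sub_le hv ha hSTT.le hhi)).2]

end Estimator

theorem eventually_mul_le_of_tendsto_div {u : ℕ → ℝ} {r : ℝ} (hr : 0 < r)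
    (h : Tendsto (fun T : ℕ => u T / T) atTop (𝓝 r)) : ∀ᶠ T : ℕ in atTop, r / 2 * T ≤ u T := by
  filter_upwards [h.eventually_const_le (half_lt_self hr), eventually_gt_atTop 0] with T h1 hT
  rwa [le_div_iff₀ (by exact_mod_cast hT)] at h1

theorem eventually_le_mul_of_tendsto_div {u : ℕ → ℝ}
    (h : Tendsto (fun T : ℕ => u T / T) atTop (𝓝 0)) {ε : ℝ} (hε : 0 < ε) :
    ∀ᶠ T : ℕ in atTop, u T ≤ ε * T := by
  filter_upwards [h.eventually_le_const hε, eventually_gt_atTop 0] with T h1 hT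
  rwa [div_le_iff₀ (by exact_mod_cast hT)] at h1

end PrefAttach

/-! ### The main theorem. -/

theorem theorem2p3
    -- vertex counts and attachment parameters of the network observed up to time `T`
    (v : ℕ → ℕ → ℕ) (a : ℕ → ℕ → ℝ)
    (hv_zero : ∀ T, v T 0 = 1)
    (hv_step : ∀ T t, v T (t + 1) = v T t ∨ v T (t + 1) = v T t + 1)
    (p : ℝ) (hp : 0 < p) (hv_lower : ∀ T t, 0 < t → p ≤ (v T t : ℝ) / (t : ℝ))
    (K : ℝ) (ha : ∀ T t, -1 < a T t ∧ a T t ≤ K)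
    -- the interval `[S, T]` with the change point `R`, and the two parameter values
    (S R : ℕ → ℕ) (α₁ α₂ : ℝ) (hα₁ : -1 < α₁) (hα₂ : -1 < α₂) (hα : 0 < |α₂ - α₁|)
    (hSRT : ∀ᶠ T in atTop, S T < R T ∧ R T < T)
    (ha₁ : ∀ᶠ T in atTop, ∀ t, S T ≤ t → t < R T → a T t = α₁)
    (ha₂ : ∀ᶠ T in atTop, ∀ t, R T ≤ t → t ≤ T → a T t = α₂)
    -- the estimator: any choice of a minimizer, wherever there is one
    (ahat : ℕ → PrefAttach.Path → ℝ)
    (hahat : ∀ T ω, (PrefAttach.argmin (a T) (v T) (S T) T ω).Nonempty →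
      ahat T ω ∈ PrefAttach.argmin (a T) (v T) (S T) T ω) :
    ((∃ δ : ℝ, 0 < δ ∧ ∀ᶠ T : ℕ in atTop, δ ≤ ((T : ℝ) - (S T : ℝ)) / (T : ℝ)) →
      Tendsto (fun T => PrefAttach.law (a T) (v T) T
        {ω | PrefAttach.argmin (a T) (v T) (S T) T ω = {ahat T ω} ∧
          PrefAttach.f (a T) (v T) (S T) T (ahat T ω) ω = (PrefAttach.x T ω : ℝ)})
        atTop (𝓝 1)) ∧
    ((∃ r : ℝ, 0 < r ∧ Tendsto (fun T : ℕ => ((T : ℝ) - (R T : ℝ)) / (T : ℝ)) atTop (𝓝 r)) →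
      (∃ r : ℝ, 0 < r ∧ Tendsto (fun T : ℕ => ((R T : ℝ) - (S T : ℝ)) / (T : ℝ)) atTop (𝓝 r)) →
      ∃ c : ℝ, 0 < c ∧
        Tendsto (fun T => PrefAttach.law (a T) (v T) T
          {ω | c < min |ahat T ω - α₁| |ahat T ω - α₂|}) atTop (𝓝 1)) ∧
    ((∃ r : ℝ, 0 < r ∧ Tendsto (fun T : ℕ => ((T : ℝ) - (R T : ℝ)) / (T : ℝ)) atTop (𝓝 r)) →
      Tendsto (fun T : ℕ => ((R T : ℝ) - (S T : ℝ)) / (T : ℝ)) atTop (𝓝 0) →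
      ∀ ε : ℝ, 0 < ε →
        Tendsto (fun T => PrefAttach.law (a T) (v T) T {ω | |ahat T ω - α₂| < ε})
          atTop (𝓝 1)) ∧
    ((∃ r : ℝ, 0 < r ∧ Tendsto (fun T : ℕ => ((R T : ℝ) - (S T : ℝ)) / (T : ℝ)) atTop (𝓝 r)) →
      Tendsto (fun T : ℕ => ((T : ℝ) - (R T : ℝ)) / (T : ℝ)) atTop (𝓝 0) →
      ∀ ε : ℝ, 0 < ε →
        Tendsto (fun T => PrefAttach.law (a T) (v T) T {ω | |ahat T ω - α₁| < ε})
          atTop (𝓝 1)) := by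
  have hv : ∀ T, PrefAttach.IsCounts (v T) := fun T => ⟨hv_zero T, hv_step T⟩
  have hpv : ∀ T n : ℕ, 0 < n → p * n ≤ v T n := fun T n hn => by
    rw [← le_div_iff₀ (by exact_mod_cast hn)]
    exact hv_lower T n hn
  have haK : ∀ T t, a T t ≤ K := fun T t => (ha T t).2
  replace ha : ∀ T t, -1 < a T t := fun T t => (ha T t).1
  have hST : ∀ᶠ T in atTop, S T < T := hSRT.mono fun T h => h.1.trans h.2
  have hne : α₁ ≠ α₂ := by
    rintro rfl
    simp at hα
  have hvalues : ∀ᶠ T in atTop, ∀ t, S T < t → t ≤ T →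
      min α₁ α₂ ≤ a T t ∧ a T t ≤ max α₁ α₂ := by
    filter_upwards [ha₁, ha₂] with T h₁ h₂ t ht htT
    rcases Nat.lt_or_ge t (R T) with h | h
    · rw [h₁ t ht.le h]
      exact ⟨min_le_left _ _, le_max_left _ _⟩
    · rw [h₂ t h htT]
      exact ⟨min_le_right _ _, le_max_right _ _⟩
  have hmain := fun hlin => PrefAttach.exists_argmin_eq hv ha hp hpv haK hST hahat hlin (lt_min hα₁ hα₂)
    min_le_max hvalues
  have hspl₁ : ∀ T t, -1 < PrefAttach.splice (a T) (S T) α₁ t := fun T => PrefAttach.neg_one_lt_splice (ha T) _ hα₁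
  have hspl₂ : ∀ T t, -1 < PrefAttach.splice (a T) (S T) α₂ t := fun T => PrefAttach.neg_one_lt_splice (ha T) _ hα₂
  -- The step from n to n+1 uses the parameter at n+1, so the second value already acts from n = R-1
  -- on.
  have hcompare₁ : ∀ᶠ T in atTop, ∀ n < T, PrefAttach.splice (a T) (S T) α₁ (n + 1) = a T (n + 1) ∨
      R T - 1 ≤ n ∧ PrefAttach.splice (a T) (S T) α₁ (n + 1) = α₁ ∧ a T (n + 1) = α₂ := by
    filter_upwards [ha₁, ha₂] with T h₁ h₂ n hn
    rcases Nat.lt_or_ge n (S T) with h | h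
    · exact Or.inl (PrefAttach.splice_of_le _ _ h)
    · rw [PrefAttach.splice_of_lt _ _ (by omega)]
      rcases Nat.lt_or_ge (n + 1) (R T) with h' | h'
      · exact Or.inl (h₁ _ (by omega) h').symm
      · exact Or.inr ⟨by omega, rfl, h₂ _ h' hn⟩
  have hcompare₂ : ∀ᶠ T in atTop, ∀ n < T, PrefAttach.splice (a T) (S T) α₂ (n + 1) = a T (n + 1) ∨
      S T ≤ n ∧ n < R T ∧ PrefAttach.splice (a T) (S T) α₂ (n + 1) = α₂ ∧ a T (n + 1) = α₁ := by
    filter_upwards [ha₁, ha₂] with T h₁ h₂ n hn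
    rcases Nat.lt_or_ge n (S T) with h | h
    · exact Or.inl (PrefAttach.splice_of_le _ _ h)
    · rw [PrefAttach.splice_of_lt _ _ (by omega)]
      rcases Nat.lt_or_ge (n + 1) (R T) with h' | h'
      · exact Or.inr ⟨h, by omega, rfl, h₁ _ (by omega) h'⟩
      · exact Or.inl (h₂ _ h' hn).symm
  have hlinR : (∃ r : ℝ, 0 < r ∧
      Tendsto (fun T : ℕ => ((T : ℝ) - (R T : ℝ)) / (T : ℝ)) atTop (𝓝 r)) →
      ∃ δ : ℝ, 0 < δ ∧ ∀ᶠ T : ℕ in atTop, (S T : ℝ) + δ * T ≤ T := by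
    rintro ⟨r, hr, h⟩
    refine ⟨r / 2, half_pos hr, ?_⟩
    filter_upwards [PrefAttach.eventually_mul_le_of_tendsto_div hr h, hSRT] with T h1 h2
    have : (S T : ℝ) ≤ R T := by exact_mod_cast h2.1.le
    linarith
  have hlinS : (∃ r : ℝ, 0 < r ∧
      Tendsto (fun T : ℕ => ((R T : ℝ) - (S T : ℝ)) / (T : ℝ)) atTop (𝓝 r)) →
      ∃ δ : ℝ, 0 < δ ∧ ∀ᶠ T : ℕ in atTop, (S T : ℝ) + δ * T ≤ T := by
    rintro ⟨r, hr, h⟩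
    refine ⟨r / 2, half_pos hr, ?_⟩
    filter_upwards [PrefAttach.eventually_mul_le_of_tendsto_div hr h, hSRT] with T h1 h2
    have : (R T : ℝ) ≤ T := by exact_mod_cast h2.2.le
    linarith
  refine ⟨?_, ?_, ?_, ?_⟩
  · rintro ⟨δ, hδ, h⟩
    obtain ⟨ε, hε, hgood⟩ := hmain ⟨δ, hδ, by
      filter_upwards [h, eventually_gt_atTop 0] with T h1 hT
      rw [le_div_iff₀ (by exact_mod_cast hT)] at h1
      linarith⟩
    exact PrefAttach.tendsto_law_of_closeToMean hv ha hST hε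
      (hgood.mono fun T h ω hω => ⟨(h ω hω).1, (h ω hω).2.1⟩)
  · intro hTR hRS
    obtain ⟨ε, hε, hgood⟩ := hmain (hlinR hTR)
    obtain ⟨r, hr, hTR⟩ := hTR
    obtain ⟨s, hs, hRS⟩ := hRS
    have hB : ∀ i : ℝ, i = α₁ ∨ i = α₂ → ∀ T t, PrefAttach.splice (a T) (S T) i t ≤
        max (max K (max α₁ α₂)) 0 := by
      intro i hi T t
      refine le_trans ?_ (le_max_left _ _)
      unfold PrefAttach.splice
      split_ifs
      · refine le_trans ?_ (le_max_right _ _)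
        rcases hi with rfl | rfl
        exacts [le_max_left _ _, le_max_right _ _]
      · exact (haK T t).trans (le_max_left _ _)
    have hB' : ∀ T t, a T t ≤ max (max K (max α₁ α₂)) 0 := fun T t =>
      (haK T t).trans ((le_max_left _ _).trans (le_max_left _ _))
    obtain ⟨c₁, hc₁, N₁, hN₁⟩ := PrefAttach.exists_abs_mean_gap (B := max (max K (max α₁ α₂)) 0)
      hp (half_pos hr) hne (le_max_right _ _)
    -- The comparison interval ends at R-1; passing from s/2 to s/4 absorbs this missing step once T
    -- ≥ 4/s.
    obtain ⟨c₂, hc₂, N₂, hN₂⟩ := PrefAttach.exists_abs_mean_gap (B := max (max K (max α₁ α₂)) 0)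
      hp (half_pos (half_pos hs)) hne.symm (le_max_right _ _)
    have hgap₁ : ∀ᶠ T : ℕ in atTop,
        c₁ * T ≤ |PrefAttach.mean (v T) (a T) T - PrefAttach.mean (v T) (PrefAttach.splice (a T) (S T) α₁) T| := by
      filter_upwards [tendsto_natCast_atTop_atTop.eventually_ge_atTop N₁, hcompare₁, ha₂, hSRT,
        PrefAttach.eventually_mul_le_of_tendsto_div hr hTR] with T hT hcmp h₂ h hlin
      refine hN₁ (v T) (hv T) (hpv T) _ _ (hspl₁ T) (ha T) T hT
        (fun n hn => (hcmp n hn).imp_right And.right) (fun n _ => hB _ (Or.inl rfl) _ _)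
        (fun n _ => hB' _ _) (R T) T le_rfl (by linarith) fun n hn hnT => ⟨?_, ?_⟩
      · exact PrefAttach.splice_of_lt _ _ (by omega)
      · exact h₂ _ (by omega) hnT
    have hgap₂ : ∀ᶠ T : ℕ in atTop,
        c₂ * T ≤ |PrefAttach.mean (v T) (a T) T - PrefAttach.mean (v T) (PrefAttach.splice (a T) (S T) α₂) T| := by
      filter_upwards [tendsto_natCast_atTop_atTop.eventually_ge_atTop N₂, hcompare₂, ha₁, hSRT,
        PrefAttach.eventually_mul_le_of_tendsto_div hs hRS,
        tendsto_natCast_atTop_atTop.eventually_ge_atTop (4 / s)] with T hT hcmp h₁ h hlin hTs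
      rw [div_le_iff₀ hs] at hTs
      refine hN₂ (v T) (hv T) (hpv T) _ _ (hspl₂ T) (ha T) T hT
        (fun n hn => (hcmp n hn).imp_right fun h => h.2.2) (fun n _ => hB _ (Or.inr rfl) _ _)
        (fun n _ => hB' _ _) (S T) (R T - 1) (by omega) ?_ fun n hn hnT => ⟨?_, ?_⟩
      · rw [Nat.cast_sub (by omega)]
        push_cast
        linarith
      · exact PrefAttach.splice_of_lt _ _ (by omega)
      · exact h₁ _ (by omega) (by omega)
    refine ⟨min (c₁ / 16) (c₂ / 16), by positivity, ?_⟩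
    refine PrefAttach.tendsto_law_of_closeToMean hv ha hST (ε := min ε (min (c₁ / 8) (c₂ / 8)))
      (by positivity) ?_
    filter_upwards [hgood, PrefAttach.exists_lt_abs_sub (ahat := ahat) hv ha hST hα₁ hc₁ hgap₁,
      PrefAttach.exists_lt_abs_sub (ahat := ahat) hv ha hST hα₂ hc₂ hgap₂] with T h h₁ h₂ ω hω
    obtain ⟨-, hf, hr⟩ := h ω (hω.mono (min_le_left _ _))
    have h1 := h₁ ω (hω.mono ((min_le_right _ _).trans (min_le_left _ _))) hf hr
    have h2 := h₂ ω (hω.mono ((min_le_right _ _).trans (min_le_right _ _))) hf hr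
    exact lt_min ((min_le_left _ _).trans_lt h1) ((min_le_right _ _).trans_lt h2)
  · intro hTR hRS ρ hρ
    have hlin := hlinR hTR
    obtain ⟨ε, hε, hgood⟩ := hmain hlin
    have hsub : ∀ ε : ℝ, 0 < ε → ∀ᶠ T : ℕ in atTop,
        |PrefAttach.mean (v T) (a T) T - PrefAttach.mean (v T) (PrefAttach.splice (a T) (S T) α₂) T| ≤ ε * T := by
      intro ε hε
      filter_upwards [hcompare₂, hSRT, PrefAttach.eventually_le_mul_of_tendsto_div hRS
        (by positivity : 0 < ε / (4 * |α₂ - α₁|))] with T hcmp h hle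
      refine (PrefAttach.abs_mean_sub_le (hv T) (ha T) (hspl₂ T) h.1.le (M := |α₂ - α₁|) (fun j hj => ?_)
        hα.le).trans ?_
      · rcases hcmp j hj with h1 | ⟨h1, h2, h3, h4⟩
        · exact Or.inl h1.symm
        · rw [h3, h4, abs_sub_comm]
          exact Or.inr ⟨h1, h2, le_rfl⟩
      · calc 4 * (|α₂ - α₁| * (R T - S T))
            ≤ 4 * (|α₂ - α₁| * (ε / (4 * |α₂ - α₁|) * T)) := by gcongr
          _ = ε * T := by field_simp
    obtain ⟨ε', hε', hclose⟩ := PrefAttach.exists_abs_sub_lt (ahat := ahat) hv ha hp hpv haK hST hlin hα₂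
      hsub hρ
    refine PrefAttach.tendsto_law_of_closeToMean hv ha hST (lt_min hε hε') ?_
    filter_upwards [hgood, hclose] with T h h' ω hω
    obtain ⟨-, hf, hr⟩ := h ω (hω.mono (min_le_left _ _))
    exact h' ω (hω.mono (min_le_right _ _)) hf hr
  · intro hRS hTR ρ hρ
    have hlin := hlinS hRS
    obtain ⟨ε, hε, hgood⟩ := hmain hlin
    have hsub : ∀ ε : ℝ, 0 < ε → ∀ᶠ T : ℕ in atTop,
        |PrefAttach.mean (v T) (a T) T - PrefAttach.mean (v T) (PrefAttach.splice (a T) (S T) α₁) T| ≤ ε * T := by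
      intro ε hε
      filter_upwards [hcompare₁, hSRT, PrefAttach.eventually_le_mul_of_tendsto_div hTR
        (by positivity : 0 < ε / (8 * |α₂ - α₁|))] with T hcmp h hle
      refine (PrefAttach.abs_mean_sub_le (hv T) (ha T) (hspl₁ T) (by omega : R T - 1 ≤ T)
        (M := |α₂ - α₁|) (fun j hj => ?_) hα.le).trans ?_
      · rcases hcmp j hj with h1 | ⟨h1, h3, h4⟩
        · exact Or.inl h1.symm
        · rw [h3, h4]
          exact Or.inr ⟨h1, hj, le_rfl⟩
      · have h1 : (R T : ℝ) + 1 ≤ T := by exact_mod_cast h.2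
        rw [Nat.cast_sub (by omega), Nat.cast_one]
        -- Since R < T, the T-R+1 differing steps are at most 2(T-R); hence 8 rather than 4 in the
        -- choice above.
        calc 4 * (|α₂ - α₁| * (T - (R T - 1)))
            ≤ 4 * (|α₂ - α₁| * (2 * (ε / (8 * |α₂ - α₁|) * T))) := by
              gcongr
              linarith
          _ = ε * T := by field_simp; ring
    obtain ⟨ε', hε', hclose⟩ := PrefAttach.exists_abs_sub_lt (ahat := ahat) hv ha hp hpv haK hST hlin hα₁
      hsub hρ
    refine PrefAttach.tendsto_law_of_closeToMean hv ha hST (lt_min hε hε') ?_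
    filter_upwards [hgood, hclose] with T h h' ω hω
    obtain ⟨-, hf, hr⟩ := h ω (hω.mono (min_le_left _ _))
    exact h' ω (hω.mono (min_le_right _ _)) hf hr
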